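/- Let $A$ be an algebra over $\mathbb C$, possibly without identity, with non-degenerate product, and let $(A,\Delta)$ be a regular multiplier Hopf algebra: $\Delta:A\to M(A\otimes A)$ is a coassociative homomorphism and the maps $a\otimes b\mapsto \Delta(a)(1\otimes b)$, $(a\otimes 1)\Delta(b)$, $\Delta(a)(b\otimes 1)$, $(1\otimes a)\Delta(b)$ are bijections of $A\otimes A$ onto itself. Let $\varphi$ be a left integral, that is, a non-zero linear functional on $A$ with $(\iota\otimes\varphi)\Delta(a)=\varphi(a)1$ in $M(A)$ for all $a\in A$. Then $(A,\Delta)$ has a unique counit $\varepsilon$ and a unique (bijective) antipode $S:A\to A$. Put $\psi=\varphi\circ S$. Let $B=\widehat A=\{\varphi(\,\cdot\,a): a\in A\}$ be the dual, a space of linear functionals on $A$, with pairing $\langle a,b\rangle=b(a)$, with the product $\langle a,bb'\rangle=\langle\Delta(a),b\otimes b'\rangle$ and the coproduct adjoint to the product of $A$. Then $B$ has a unique bijective antipode $S$, and $\langle a,S(b)\rangle=\langle S(a),b\rangle$ for $a\in A$, $b\in B$. The maps $a\mapsto\varphi(\,\cdot\,a)$ and $a\mapsto\psi(S(\,\cdot\,)a)$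 are linear bijections from $A$ onto $B$, so that linear functionals $\widehat\psi$ and $\widehat\varphi$ on $B$ are well defined by $$\widehat\psi(\varphi(\,\cdot\,a))=\varepsilon(a),\qquad \widehat\varphi(\psi(S(\,\cdot\,)a))=\varepsilon(a)\qquad(a\in A).$$ Moreover: (1) The inverse of the map $a\mapsto\varphi(\,\cdot\,a)$ from $A$ to $B$ is the map $b\mapsto\widehat\psi(S(\,\cdot\,)b)$ from $B$ to $A$. That is, if $b\in B$, then the element $a\in A$ with $b=\varphi(\,\cdot\,a)$ is the only element of $A$ satisfying $\langle a,b'\rangle=\widehat\psi(S(b')b)$ for all $b'\in B$. (2) The inverse of the map $a\mapsto\psi(S(\,\cdot\,)a)$ from $A$ to $B$ is the map $b\mapsto\widehat\varphi(\,\cdot\,b)$ from $B$ to $A$. That is, if $b\in B$, then the element $a\in A$ with $b=\psi(S(\,\cdot\,)a)$ is the only element of $A$ satisfying $\langle a,b'\rangle=\widehat\varphi(b'b)$ for all $b'\in B$. -/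

import Mathlib

open scoped TensorProduct

set_option linter.unusedSectionVars false

noncomputable section

namespace MHA

/-- The multiplier algebra `M(R)` of a (non-degenerate, possibly non-unital) complex algebra `R`.
A multiplier `m` is the pair of linear maps `x ↦ m x` and `x ↦ x m` of `R` into itself, subject to
`(x m) y = x (m y)`. The product is `(m n) x = m (n x)` and `x (m n) = (x m) n`. -/
def MultiplierAlgebra (R : Type*) [NonUnitalRing R] [Module ℂ R] [IsScalarTower ℂ R R]
    [SMulCommClass ℂ R R] : Subalgebra ℂ (Module.End ℂ R × (Module.End ℂ R)ᵐᵒᵖ) where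
  carrier := {p | ∀ x y : R, p.2.unop x * y = x * p.1 y}
  mul_mem' := by
    intro p q hp hq x y
    simp only [Prod.snd_mul, Prod.fst_mul, MulOpposite.unop_mul, Module.End.mul_apply]
    rw [hq, hp]
  add_mem' := by
    intro p q hp hq x y
    simp only [Prod.snd_add, Prod.fst_add, MulOpposite.unop_add, LinearMap.add_apply, add_mul,
      mul_add, hp x y, hq x y]
  algebraMap_mem' := by
    intro r x y
    simp [Prod.algebraMap_apply, MulOpposite.algebraMap_apply, Module.algebraMap_end_apply,
      smul_mul_assoc, mul_smul_comm]

section Multipliers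

variable {R : Type*} [NonUnitalRing R] [Module ℂ R] [IsScalarTower ℂ R R] [SMulCommClass ℂ R R]

/-- The action `x ↦ m x` of a multiplier `m`. -/
def leftMul (m : MultiplierAlgebra R) : R →ₗ[ℂ] R := m.1.1

/-- The action `x ↦ x m` of a multiplier `m`. -/
def rightMul (m : MultiplierAlgebra R) : R →ₗ[ℂ] R := m.1.2.unop

/-- An element of `R`, regarded as an element of `M(R)`. -/
def ofElem (r : R) : MultiplierAlgebra R :=
  ⟨(LinearMap.mulLeft ℂ r, MulOpposite.op (LinearMap.mulRight ℂ r)), fun x y => by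
    simp [mul_assoc]⟩

/-- The product of `R` is non-degenerate. -/
def NondegenerateProduct (R : Type*) [NonUnitalRing R] : Prop :=
  (∀ a : R, (∀ b : R, a * b = 0) → a = 0) ∧ (∀ b : R, (∀ a : R, a * b = 0) → b = 0)

theorem rightMul_mul_eq (m : MultiplierAlgebra R) (x y : R) :
    rightMul m x * y = x * leftMul m y := m.2 x y

theorem leftMul_mul (hR : NondegenerateProduct R) (m : MultiplierAlgebra R)
    (x y : R) : leftMul m (x * y) = leftMul m x * y := by
  rw [← sub_eq_zero]
  refine hR.2 _ fun z => ?_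
  rw [mul_sub, ← rightMul_mul_eq, ← mul_assoc, rightMul_mul_eq, mul_assoc, sub_self]

end Multipliers

section Slices

variable {V : Type*} [AddCommMonoid V] [Module ℂ V]

/-- The slice map `ω ⊗ ι : V ⊗ V → V`. -/
def sliceLeft (ω : Module.Dual ℂ V) : V ⊗[ℂ] V →ₗ[ℂ] V :=
  (TensorProduct.lid ℂ V).toLinearMap ∘ₗ TensorProduct.map ω LinearMap.id

/-- The slice map `ι ⊗ ω : V ⊗ V → V`. -/
def sliceRight (ω : Module.Dual ℂ V) : V ⊗[ℂ] V →ₗ[ℂ] V :=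
  (TensorProduct.rid ℂ V).toLinearMap ∘ₗ TensorProduct.map LinearMap.id ω

@[simp] theorem sliceLeft_tmul (ω : Module.Dual ℂ V) (a b : V) :
    sliceLeft ω (a ⊗ₜ b) = ω a • b := by simp [sliceLeft]

@[simp] theorem sliceRight_tmul (ω : Module.Dual ℂ V) (a b : V) :
    sliceRight ω (a ⊗ₜ b) = ω b • a := by simp [sliceRight]

end Slices

section Tensor

variable {A : Type*} [NonUnitalRing A] [Module ℂ A] [IsScalarTower ℂ A A] [SMulCommClass ℂ A A]

/-- The multiplier `1 ⊗ b` of `A ⊗ A`. -/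
def oneTmul (b : A) : MultiplierAlgebra (A ⊗[ℂ] A) :=
  ⟨(TensorProduct.map LinearMap.id (LinearMap.mulLeft ℂ b),
    MulOpposite.op (TensorProduct.map LinearMap.id (LinearMap.mulRight ℂ b))), fun x y => by
    induction x with
    | zero => simp
    | add x₁ x₂ h₁ h₂ => simp only [map_add, add_mul, h₁, h₂]
    | tmul p q =>
      induction y with
      | zero => simp
      | add y₁ y₂ h₁ h₂ => simp only [map_add, mul_add, h₁, h₂]
      | tmul r s => simp [mul_assoc]⟩

/-- The multiplier `a ⊗ 1` of `A ⊗ A`. -/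
def tmulOne (a : A) : MultiplierAlgebra (A ⊗[ℂ] A) :=
  ⟨(TensorProduct.map (LinearMap.mulLeft ℂ a) LinearMap.id,
    MulOpposite.op (TensorProduct.map (LinearMap.mulRight ℂ a) LinearMap.id)), fun x y => by
    induction x with
    | zero => simp
    | add x₁ x₂ h₁ h₂ => simp only [map_add, add_mul, h₁, h₂]
    | tmul p q =>
      induction y with
      | zero => simp
      | add y₁ y₂ h₁ h₂ => simp only [map_add, mul_add, h₁, h₂]
      | tmul r s => simp [mul_assoc]⟩

/-- The functional `ω ⊗ ω'` on `A ⊗ A`. -/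
def tensorFunctional (ω ω' : Module.Dual ℂ A) : Module.Dual ℂ (A ⊗[ℂ] A) :=
  (TensorProduct.lid ℂ ℂ).toLinearMap ∘ₗ TensorProduct.map ω ω'

/-- The product of `A`, as a linear map `A ⊗ A → A`. -/
def mulTensor (A : Type*) [NonUnitalRing A] [Module ℂ A] [IsScalarTower ℂ A A]
    [SMulCommClass ℂ A A] : A ⊗[ℂ] A →ₗ[ℂ] A :=
  TensorProduct.lift (LinearMap.mul ℂ A)

@[simp] theorem tensorFunctional_tmul (ω ω' : Module.Dual ℂ A) (a b : A) :
    tensorFunctional ω ω' (a ⊗ₜ b) = ω a * ω' b := by simp [tensorFunctional]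

@[simp] theorem mulTensor_tmul (a b : A) : mulTensor A (a ⊗ₜ b) = a * b := by simp [mulTensor]

theorem eq_zero_of_sliceLeft (z : A ⊗[ℂ] A) (h : ∀ ω, sliceLeft ω z = 0) : z = 0 := by
  classical
  let e := Module.Basis.ofVectorSpace ℂ A
  apply (TensorProduct.equivFinsuppOfBasisLeft (N := A) e).injective
  rw [map_zero]
  ext i
  have key : ∀ z : A ⊗[ℂ] A,
      TensorProduct.equivFinsuppOfBasisLeft e z i = sliceLeft (e.coord i) z := by
    intro z
    induction z with
    | zero => simp
    | add x y hx hy => simp [hx, hy]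
    | tmul a b => simp [TensorProduct.equivFinsuppOfBasisLeft_apply_tmul]
  rw [key, h]
  rfl

theorem eq_zero_of_sliceRight (z : A ⊗[ℂ] A) (h : ∀ ω, sliceRight ω z = 0) : z = 0 := by
  have h' : TensorProduct.comm ℂ A A z = 0 := by
    refine eq_zero_of_sliceLeft _ fun ω => ?_
    rw [← h ω]
    induction z with
    | zero => simp
    | add x y hx hy =>
      have key : ∀ z : A ⊗[ℂ] A, sliceLeft ω (TensorProduct.comm ℂ A A z) = sliceRight ω z := by
        intro z
        induction z with
        | zero => simp
        | add x y hx hy => simp [hx, hy]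
        | tmul a b => simp
      exact key _
    | tmul a b => simp
  simpa using h'

theorem eq_zero_of_mulRight_snd (hA : NondegenerateProduct A) (z : A ⊗[ℂ] A)
    (h : ∀ v : A, TensorProduct.map LinearMap.id (LinearMap.mulRight ℂ v) z = 0) : z = 0 := by
  refine eq_zero_of_sliceLeft z fun ω => hA.1 _ fun v => ?_
  have key : ∀ z : A ⊗[ℂ] A, sliceLeft ω z * v =
      sliceLeft ω (TensorProduct.map LinearMap.id (LinearMap.mulRight ℂ v) z) := by
    intro z
    induction z with
    | zero => simp
    | add x y hx hy => simp [hx, hy, add_mul]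
    | tmul a b => simp [smul_mul_assoc]
  rw [key, h, map_zero]

theorem eq_zero_of_mulRight_fst (hA : NondegenerateProduct A) (z : A ⊗[ℂ] A)
    (h : ∀ u : A, TensorProduct.map (LinearMap.mulRight ℂ u) LinearMap.id z = 0) : z = 0 := by
  refine eq_zero_of_sliceRight z fun ω => hA.1 _ fun u => ?_
  have key : ∀ z : A ⊗[ℂ] A, sliceRight ω z * u =
      sliceRight ω (TensorProduct.map (LinearMap.mulRight ℂ u) LinearMap.id z) := by
    intro z
    induction z with
    | zero => simp
    | add x y hx hy => simp [hx, hy, add_mul]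
    | tmul a b => simp [smul_mul_assoc]
  rw [key, h, map_zero]

theorem eq_zero_of_mulLeft_snd (hA : NondegenerateProduct A) (z : A ⊗[ℂ] A)
    (h : ∀ v : A, TensorProduct.map LinearMap.id (LinearMap.mulLeft ℂ v) z = 0) : z = 0 := by
  refine eq_zero_of_sliceLeft z fun ω => hA.2 _ fun v => ?_
  have key : ∀ z : A ⊗[ℂ] A, v * sliceLeft ω z =
      sliceLeft ω (TensorProduct.map LinearMap.id (LinearMap.mulLeft ℂ v) z) := by
    intro z
    induction z with
    | zero => simp
    | add x y hx hy => simp [hx, hy, mul_add]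
    | tmul a b => simp [mul_smul_comm]
  rw [key, h, map_zero]

theorem eq_zero_of_mulLeft_fst (hA : NondegenerateProduct A) (z : A ⊗[ℂ] A)
    (h : ∀ u : A, TensorProduct.map (LinearMap.mulLeft ℂ u) LinearMap.id z = 0) : z = 0 := by
  refine eq_zero_of_sliceRight z fun ω => hA.2 _ fun u => ?_
  have key : ∀ z : A ⊗[ℂ] A, u * sliceRight ω z =
      sliceRight ω (TensorProduct.map (LinearMap.mulLeft ℂ u) LinearMap.id z) := by
    intro z
    induction z with
    | zero => simp
    | add x y hx hy => simp [hx, hy, mul_add]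
    | tmul a b => simp [mul_smul_comm]
  rw [key, h, map_zero]

theorem mul_tmul_eq (z : A ⊗[ℂ] A) (u v : A) : z * (u ⊗ₜ[ℂ] v) =
    TensorProduct.map LinearMap.id (LinearMap.mulRight ℂ v)
      (TensorProduct.map (LinearMap.mulRight ℂ u) LinearMap.id z) := by
  induction z with
  | zero => simp
  | add x y hx hy => simp [hx, hy, add_mul]
  | tmul a b => simp

theorem tmul_mul_eq (z : A ⊗[ℂ] A) (u v : A) : (u ⊗ₜ[ℂ] v) * z =
    TensorProduct.map LinearMap.id (LinearMap.mulLeft ℂ v)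
      (TensorProduct.map (LinearMap.mulLeft ℂ u) LinearMap.id z) := by
  induction z with
  | zero => simp
  | add x y hx hy => simp [hx, hy, mul_add]
  | tmul a b => simp

theorem NondegenerateProduct.tensor (hA : NondegenerateProduct A) :
    NondegenerateProduct (A ⊗[ℂ] A) := by
  constructor
  · intro z h
    refine eq_zero_of_mulRight_fst hA z fun u => eq_zero_of_mulRight_snd hA _ fun v => ?_
    rw [← mul_tmul_eq, h]
  · intro z h
    refine eq_zero_of_mulLeft_fst hA z fun u => eq_zero_of_mulLeft_snd hA _ fun v => ?_
    rw [← tmul_mul_eq, h]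

end Tensor

/-- A regular multiplier Hopf algebra structure on the complex algebra `A`: the product of `A` is
non-degenerate, the coproduct `Δ : A → M(A ⊗ A)` is a homomorphism, all the products
`Δ(a)(1 ⊗ b)`, `(a ⊗ 1)Δ(b)`, `Δ(a)(b ⊗ 1)`, `(1 ⊗ a)Δ(b)` lie in `A ⊗ A` and induce bijections
of `A ⊗ A` (these bijections `T₁`, `T₂`, `T₃`, `T₄` are determined by `Δ`), and `Δ` is
coassociative:
`(a ⊗ 1 ⊗ 1)(Δ ⊗ ι)(Δ(b)(1 ⊗ c)) = (ι ⊗ Δ)((a ⊗ 1)Δ(b))(1 ⊗ 1 ⊗ c)`. -/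
structure RegularMultiplierHopfAlgebra (A : Type*) [NonUnitalRing A] [Module ℂ A]
    [IsScalarTower ℂ A A] [SMulCommClass ℂ A A] where
  nondegenerate : NondegenerateProduct A
  Δ : A →ₙₐ[ℂ] MultiplierAlgebra (A ⊗[ℂ] A)
  T₁ : (A ⊗[ℂ] A) ≃ₗ[ℂ] (A ⊗[ℂ] A)
  of_T₁ : ∀ a b : A, ofElem (T₁ (a ⊗ₜ b)) = Δ a * oneTmul b
  T₂ : (A ⊗[ℂ] A) ≃ₗ[ℂ] (A ⊗[ℂ] A)
  of_T₂ : ∀ a b : A, ofElem (T₂ (a ⊗ₜ b)) = tmulOne a * Δ b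
  T₃ : (A ⊗[ℂ] A) ≃ₗ[ℂ] (A ⊗[ℂ] A)
  of_T₃ : ∀ a b : A, ofElem (T₃ (a ⊗ₜ b)) = Δ a * tmulOne b
  T₄ : (A ⊗[ℂ] A) ≃ₗ[ℂ] (A ⊗[ℂ] A)
  of_T₄ : ∀ a b : A, ofElem (T₄ (a ⊗ₜ b)) = oneTmul a * Δ b
  coassoc : ∀ a b c : A,
    TensorProduct.map T₂.toLinearMap LinearMap.id
        ((TensorProduct.assoc ℂ A A A).symm (a ⊗ₜ T₁ (b ⊗ₜ c))) =
      (TensorProduct.assoc ℂ A A A).symm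
        (TensorProduct.map LinearMap.id T₁.toLinearMap
          (TensorProduct.assoc ℂ A A A (T₂ (a ⊗ₜ b) ⊗ₜ c)))

/-- The linear map `a ↦ ω(· a)` from `A` to its dual space. -/
def rightTranslate {A : Type*} [NonUnitalRing A] [Module ℂ A] [IsScalarTower ℂ A A]
    [SMulCommClass ℂ A A] (ω : Module.Dual ℂ A) : A →ₗ[ℂ] Module.Dual ℂ A where
  toFun a := ω ∘ₗ LinearMap.mulRight ℂ a
  map_add' a b := by ext x; simp [mul_add]
  map_smul' r a := by ext x; simp [mul_smul_comm]

/-- The underlying space of the dual `Â`: the functionals `φ(· a)` with `a ∈ A`. The pairing of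
`A` with `Â` is evaluation. -/
def dualSpace {A : Type*} [NonUnitalRing A] [Module ℂ A] [IsScalarTower ℂ A A]
    [SMulCommClass ℂ A A] (φ : Module.Dual ℂ A) : Submodule ℂ (Module.Dual ℂ A) :=
  LinearMap.range (rightTranslate φ)

namespace RegularMultiplierHopfAlgebra

variable {A : Type*} [NonUnitalRing A] [Module ℂ A] [IsScalarTower ℂ A A] [SMulCommClass ℂ A A]
variable (H : RegularMultiplierHopfAlgebra A)

/-- `ε` is a counit: a homomorphism `A → ℂ` such that `(ε ⊗ ι)(Δ(a)(1 ⊗ b)) = ab` and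
`(ι ⊗ ε)((a ⊗ 1)Δ(b)) = ab`. -/
def IsCounit (ε : A →ₙₐ[ℂ] ℂ) : Prop :=
  (∀ a b : A, sliceLeft (ε : A →ₗ[ℂ] ℂ) (H.T₁ (a ⊗ₜ b)) = a * b) ∧
    (∀ a b : A, sliceRight (ε : A →ₗ[ℂ] ℂ) (H.T₂ (a ⊗ₜ b)) = a * b)

/-- `S` is an antipode (for the counit `ε`): with `m` the product,
`m((S ⊗ ι)(Δ(a)(1 ⊗ b))) = ε(a)b` and `m((ι ⊗ S)((a ⊗ 1)Δ(b))) = ε(b)a`. -/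
def IsAntipode (ε : A →ₙₐ[ℂ] ℂ) (S : A ≃ₗ[ℂ] A) : Prop :=
  (∀ a b : A, mulTensor A (TensorProduct.map S.toLinearMap LinearMap.id (H.T₁ (a ⊗ₜ b)))
      = ε a • b) ∧
    (∀ a b : A, mulTensor A (TensorProduct.map LinearMap.id S.toLinearMap (H.T₂ (a ⊗ₜ b)))
      = ε b • a)

/-- `φ` is a left integral: a non-zero functional with `(ι ⊗ φ)Δ(a) = φ(a)1` in `M(A)`, that is,
`(ι ⊗ φ)(Δ(a)(b ⊗ 1)) = φ(a)b` and `(ι ⊗ φ)((b ⊗ 1)Δ(a)) = φ(a)b`. -/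
def IsLeftIntegral (φ : Module.Dual ℂ A) : Prop :=
  φ ≠ 0 ∧ (∀ a b : A, sliceRight φ (H.T₃ (a ⊗ₜ b)) = φ a • b) ∧
    (∀ a b : A, sliceRight φ (H.T₂ (b ⊗ₜ a)) = φ a • b)

/-- The functional `a ↦ ⟨Δ(a), φ(· c) ⊗ φ(· c')⟩ = (φ ⊗ φ)(Δ(a)(c ⊗ c'))`. -/
def convolution (φ : Module.Dual ℂ A) (c c' : A) : Module.Dual ℂ A where
  toFun a := tensorFunctional φ φ (leftMul (H.Δ a) (c ⊗ₜ c'))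
  map_add' a b := by simp [leftMul]
  map_smul' r a := by simp [leftMul]

theorem convolution_apply (φ : Module.Dual ℂ A) (c c' a : A) :
    H.convolution φ c c' a = tensorFunctional φ φ (leftMul (H.Δ a) (c ⊗ₜ c')) := rfl

theorem left_tmul_eq_T₁ (a c c' : A) : leftMul (H.Δ a) (c ⊗ₜ c') =
    TensorProduct.map (LinearMap.mulRight ℂ c) LinearMap.id (H.T₁ (a ⊗ₜ c')) := by
  rw [← sub_eq_zero]
  refine eq_zero_of_mulRight_snd H.nondegenerate _ fun v =>
    eq_zero_of_mulRight_fst H.nondegenerate _ fun u => ?_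
  have h := congrArg (fun m => leftMul m ((c * u) ⊗ₜ[ℂ] v)) (H.of_T₁ a c')
  have h₂ : H.T₁ (a ⊗ₜ c') * ((c * u) ⊗ₜ[ℂ] v) = leftMul (H.Δ a) ((c * u) ⊗ₜ[ℂ] (c' * v)) := h
  have h₃ : leftMul (H.Δ a) ((c * u) ⊗ₜ[ℂ] (c' * v))
      = leftMul (H.Δ a) (c ⊗ₜ c') * (u ⊗ₜ[ℂ] v) := by
    rw [← leftMul_mul H.nondegenerate.tensor]
    simp
  rw [h₃] at h₂
  have k₁ : ∀ z : A ⊗[ℂ] A, TensorProduct.map (LinearMap.mulRight ℂ u) LinearMap.id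
      (TensorProduct.map LinearMap.id (LinearMap.mulRight ℂ v) z) = z * (u ⊗ₜ[ℂ] v) := by
    intro z
    induction z with
    | zero => simp
    | add x y hx hy => simp only [map_add, hx, hy, add_mul]
    | tmul a b => simp
  have k₂ : ∀ z : A ⊗[ℂ] A, TensorProduct.map (LinearMap.mulRight ℂ c) LinearMap.id z *
      (u ⊗ₜ[ℂ] v) = z * ((c * u) ⊗ₜ[ℂ] v) := by
    intro z
    induction z with
    | zero => simp
    | add x y hx hy => simp only [map_add, hx, hy, add_mul]
    | tmul a b => simp [mul_assoc]
  rw [k₁, sub_mul, k₂, h₂, sub_self]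

theorem left_tmul_eq_T₃ (a c c' : A) : leftMul (H.Δ a) (c ⊗ₜ c') =
    TensorProduct.map LinearMap.id (LinearMap.mulRight ℂ c') (H.T₃ (a ⊗ₜ c)) := by
  rw [← sub_eq_zero]
  refine eq_zero_of_mulRight_snd H.nondegenerate _ fun v =>
    eq_zero_of_mulRight_fst H.nondegenerate _ fun u => ?_
  have h := congrArg (fun m => leftMul m (u ⊗ₜ[ℂ] (c' * v))) (H.of_T₃ a c)
  have h₂ : H.T₃ (a ⊗ₜ c) * (u ⊗ₜ[ℂ] (c' * v)) = leftMul (H.Δ a) ((c * u) ⊗ₜ[ℂ] (c' * v)) := h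
  have h₃ : leftMul (H.Δ a) ((c * u) ⊗ₜ[ℂ] (c' * v))
      = leftMul (H.Δ a) (c ⊗ₜ c') * (u ⊗ₜ[ℂ] v) := by
    rw [← leftMul_mul H.nondegenerate.tensor]
    simp
  rw [h₃] at h₂
  have k₁ : ∀ z : A ⊗[ℂ] A, TensorProduct.map (LinearMap.mulRight ℂ u) LinearMap.id
      (TensorProduct.map LinearMap.id (LinearMap.mulRight ℂ v) z) = z * (u ⊗ₜ[ℂ] v) := by
    intro z
    induction z with
    | zero => simp
    | add x y hx hy => simp only [map_add, hx, hy, add_mul]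
    | tmul a b => simp
  have k₂ : ∀ z : A ⊗[ℂ] A, TensorProduct.map LinearMap.id (LinearMap.mulRight ℂ c') z *
      (u ⊗ₜ[ℂ] v) = z * (u ⊗ₜ[ℂ] (c' * v)) := by
    intro z
    induction z with
    | zero => simp
    | add x y hx hy => simp only [map_add, hx, hy, add_mul]
    | tmul a b => simp [mul_assoc]
  rw [k₁, sub_mul, k₂, h₂, sub_self]

theorem convolution_eq_T₁ (φ : Module.Dual ℂ A) (c c' a : A) : H.convolution φ c c' a
    = tensorFunctional (rightTranslate φ c) φ (H.T₁ (a ⊗ₜ c')) := by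
  rw [convolution_apply, left_tmul_eq_T₁]
  generalize H.T₁ (a ⊗ₜ c') = z
  induction z with
  | zero => simp
  | add x y hx hy => simp only [map_add, hx, hy]
  | tmul a b => simp [rightTranslate]

theorem convolution_eq_T₃ (φ : Module.Dual ℂ A) (c c' a : A) : H.convolution φ c c' a
    = tensorFunctional φ (rightTranslate φ c') (H.T₃ (a ⊗ₜ c)) := by
  rw [convolution_apply, left_tmul_eq_T₃]
  generalize H.T₃ (a ⊗ₜ c) = z
  induction z with
  | zero => simp
  | add x y hx hy => simp only [map_add, hx, hy]
  | tmul a b => simp [rightTranslate]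

/-- The functional `convolution φ c c'` depends only on `φ(· c)` and `φ(· c')`. -/
theorem convolution_congr (φ : Module.Dual ℂ A) {c d c' d' : A}
    (h : rightTranslate φ c = rightTranslate φ d)
    (h' : rightTranslate φ c' = rightTranslate φ d') :
    H.convolution φ c c' = H.convolution φ d d' := by
  ext a
  rw [convolution_eq_T₁, h, ← convolution_eq_T₁, convolution_eq_T₃, h', ← convolution_eq_T₃]

theorem left_T₃ (a : A) (p q : A) :
    leftMul (H.Δ a) (H.T₃ (p ⊗ₜ q)) = H.T₃ ((a * p) ⊗ₜ q) := by
  rw [← sub_eq_zero]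
  refine H.nondegenerate.tensor.1 _ fun y => ?_
  rw [sub_mul, ← leftMul_mul H.nondegenerate.tensor]
  have h₁ : H.T₃ (p ⊗ₜ q) * y = leftMul (H.Δ p) (leftMul (tmulOne q) y) :=
    congrArg (fun m => leftMul m y) (H.of_T₃ p q)
  have h₂ : H.T₃ ((a * p) ⊗ₜ q) * y = leftMul (H.Δ (a * p)) (leftMul (tmulOne q) y) :=
    congrArg (fun m => leftMul m y) (H.of_T₃ (a * p) q)
  rw [h₁, h₂, map_mul]
  exact sub_self _

/-- `Â` is closed under the product. -/
theorem convolution_mem {φ : Module.Dual ℂ A} (hφ : H.IsLeftIntegral φ) (c c' : A) :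
    H.convolution φ c c' ∈ dualSpace φ := by
  have key : ∀ z : A ⊗[ℂ] A, ∃ d : A, ∀ a : A,
      tensorFunctional φ φ (leftMul (H.Δ a) (H.T₃ z)) = φ (a * d) := by
    intro z
    induction z with
    | zero => exact ⟨0, fun a => by simp⟩
    | add x y hx hy =>
      obtain ⟨d, hd⟩ := hx
      obtain ⟨e, he⟩ := hy
      exact ⟨d + e, fun a => by simp only [map_add, hd, he, mul_add]⟩
    | tmul p q =>
      refine ⟨φ q • p, fun a => ?_⟩
      have hs : ∀ w : A ⊗[ℂ] A, tensorFunctional φ φ w = φ (sliceRight φ w) := by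
        intro w
        induction w with
        | zero => simp
        | add x y hx hy => simp only [map_add, hx, hy]
        | tmul a b => simp [mul_comm]
      rw [left_T₃, hs, hφ.2.1]
      simp [mul_smul_comm, mul_comm]
  obtain ⟨d, hd⟩ := key (H.T₃.symm (c ⊗ₜ c'))
  refine ⟨d, ?_⟩
  ext a
  rw [convolution_apply]
  simpa [rightTranslate] using (hd a).symm

variable {H}

/-- The product of the dual `Â`: `⟨a, b b'⟩ = ⟨Δ(a), b ⊗ b'⟩`. Elements `c`, `c'` with
`b = φ(· c)` and `b' = φ(· c')` are chosen; the result does not depend on this choice, see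
`dualMul_apply`. -/
def IsLeftIntegral.dualMul {φ : Module.Dual ℂ A} (hφ : H.IsLeftIntegral φ)
    (b b' : dualSpace φ) : dualSpace φ :=
  ⟨H.convolution φ b.2.choose b'.2.choose, H.convolution_mem hφ _ _⟩

theorem IsLeftIntegral.dualMul_apply {φ : Module.Dual ℂ A} (hφ : H.IsLeftIntegral φ)
    (b b' : dualSpace φ) (c c' : A) (hc : (b : Module.Dual ℂ A) = rightTranslate φ c)
    (hc' : (b' : Module.Dual ℂ A) = rightTranslate φ c') (a : A) :
    (hφ.dualMul b b' : Module.Dual ℂ A) a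
      = tensorFunctional φ φ (leftMul (H.Δ a) (c ⊗ₜ c')) := by
  have h := H.convolution_congr φ (b.2.choose_spec.trans hc) (b'.2.choose_spec.trans hc')
  exact congrArg (fun f : Module.Dual ℂ A => f a) h

theorem IsLeftIntegral.dualMul_tmul {φ : Module.Dual ℂ A} (hφ : H.IsLeftIntegral φ)
    (b b' : dualSpace φ) (a c' : A) (hc' : (b' : Module.Dual ℂ A) = rightTranslate φ c') :
    (hφ.dualMul b b' : Module.Dual ℂ A) a
      = tensorFunctional (b : Module.Dual ℂ A) φ (H.T₁ (a ⊗ₜ c')) := by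
  obtain ⟨c, hc⟩ := b.2
  rw [hφ.dualMul_apply b b' c c' hc.symm hc', ← hc, ← convolution_apply, convolution_eq_T₁]

theorem IsLeftIntegral.dualMul_tmul' {φ : Module.Dual ℂ A} (hφ : H.IsLeftIntegral φ)
    (b b' : dualSpace φ) (a c : A) (hc : (b : Module.Dual ℂ A) = rightTranslate φ c) :
    (hφ.dualMul b b' : Module.Dual ℂ A) a
      = tensorFunctional φ (b' : Module.Dual ℂ A) (H.T₃ (a ⊗ₜ c)) := by
  obtain ⟨c', hc'⟩ := b'.2
  rw [hφ.dualMul_apply b b' c c' hc hc'.symm, ← hc', ← convolution_apply, convolution_eq_T₃]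

/-- The product of the dual `Â`, as a linear map `Â ⊗ Â → Â`. -/
def IsLeftIntegral.dualMulTensor {φ : Module.Dual ℂ A} (hφ : H.IsLeftIntegral φ) :
    dualSpace φ ⊗[ℂ] dualSpace φ →ₗ[ℂ] dualSpace φ :=
  TensorProduct.lift (LinearMap.mk₂ ℂ hφ.dualMul
    (fun b₁ b₂ b' => by
      obtain ⟨c', hc'⟩ := b'.2
      ext a
      simp only [Submodule.coe_add, LinearMap.add_apply, hφ.dualMul_tmul _ b' a c' hc'.symm]
      simp [tensorFunctional, TensorProduct.map_add_left])
    (fun r b b' => by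
      obtain ⟨c', hc'⟩ := b'.2
      ext a
      simp only [Submodule.coe_smul, LinearMap.smul_apply, hφ.dualMul_tmul _ b' a c' hc'.symm]
      simp [tensorFunctional, TensorProduct.map_smul_left])
    (fun b b₁ b₂ => by
      obtain ⟨c, hc⟩ := b.2
      ext a
      simp only [Submodule.coe_add, LinearMap.add_apply, hφ.dualMul_tmul' b _ a c hc.symm]
      simp [tensorFunctional, TensorProduct.map_add_right])
    (fun r b b' => by
      obtain ⟨c, hc⟩ := b.2
      ext a
      simp only [Submodule.coe_smul, LinearMap.smul_apply, hφ.dualMul_tmul' b _ a c hc.symm]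
      simp [tensorFunctional, TensorProduct.map_smul_right]))

@[simp] theorem IsLeftIntegral.dualMulTensor_tmul {φ : Module.Dual ℂ A}
    (hφ : H.IsLeftIntegral φ) (b b' : dualSpace φ) :
    hφ.dualMulTensor (b ⊗ₜ b') = hφ.dualMul b b' := by
  simp [IsLeftIntegral.dualMulTensor]

/-- The pairing of `A ⊗ A` with `Â ⊗ Â`: `⟨a ⊗ a', b ⊗ b'⟩ = ⟨a, b⟩⟨a', b'⟩`. -/
def tensorPairing (φ : Module.Dual ℂ A) :
    dualSpace φ ⊗[ℂ] dualSpace φ →ₗ[ℂ] Module.Dual ℂ (A ⊗[ℂ] A) :=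
  TensorProduct.dualDistrib ℂ A A ∘ₗ
    TensorProduct.map (dualSpace φ).subtype (dualSpace φ).subtype

/-- `T` is the map `b ⊗ b' ↦ Δ(b)(1 ⊗ b')` on `Â ⊗ Â`, where the coproduct of `Â` is the adjoint
of the product of `A`:
`⟨a ⊗ a', Δ(b)(1 ⊗ b')⟩ = ⟨(a ⊗ 1)Δ(a'), b ⊗ b'⟩`. -/
def IsDualT₁ (H : RegularMultiplierHopfAlgebra A) (φ : Module.Dual ℂ A)
    (T : dualSpace φ ⊗[ℂ] dualSpace φ →ₗ[ℂ] dualSpace φ ⊗[ℂ] dualSpace φ) : Prop :=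
  ∀ (b b' : dualSpace φ) (a a' : A), tensorPairing φ (T (b ⊗ₜ b')) (a ⊗ₜ a') =
    tensorPairing φ (b ⊗ₜ b') (H.T₂ (a ⊗ₜ a'))

/-- `T` is the map `b ⊗ b' ↦ (b ⊗ 1)Δ(b')` on `Â ⊗ Â`:
`⟨a ⊗ a', (b ⊗ 1)Δ(b')⟩ = ⟨Δ(a)(1 ⊗ a'), b ⊗ b'⟩`. -/
def IsDualT₂ (H : RegularMultiplierHopfAlgebra A) (φ : Module.Dual ℂ A)
    (T : dualSpace φ ⊗[ℂ] dualSpace φ →ₗ[ℂ] dualSpace φ ⊗[ℂ] dualSpace φ) : Prop :=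
  ∀ (b b' : dualSpace φ) (a a' : A), tensorPairing φ (T (b ⊗ₜ b')) (a ⊗ₜ a') =
    tensorPairing φ (b ⊗ₜ b') (H.T₁ (a ⊗ₜ a'))

/-- `SB` is the antipode of the dual `Â`. In terms of the maps `T₁ : b ⊗ b' ↦ Δ(b)(1 ⊗ b')` and
`T₂ : b ⊗ b' ↦ (b ⊗ 1)Δ(b')` of `Â ⊗ Â` into itself, there is a counit `εB`, that is,
`(εB ⊗ ι)(Δ(b)(1 ⊗ b')) = bb'` and `(ι ⊗ εB)((b ⊗ 1)Δ(b')) = bb'`, and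
`m((SB ⊗ ι)(Δ(b)(1 ⊗ b'))) = εB(b)b'` and `m((ι ⊗ SB)((b ⊗ 1)Δ(b'))) = εB(b')b`. -/
def IsLeftIntegral.IsDualAntipode {φ : Module.Dual ℂ A} (hφ : H.IsLeftIntegral φ)
    (SB : dualSpace φ ≃ₗ[ℂ] dualSpace φ) : Prop :=
  ∃ (T₁ T₂ : dualSpace φ ⊗[ℂ] dualSpace φ →ₗ[ℂ] dualSpace φ ⊗[ℂ] dualSpace φ)
    (εB : Module.Dual ℂ (dualSpace φ)),
    IsDualT₁ H φ T₁ ∧ IsDualT₂ H φ T₂ ∧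
    (∀ b b' : dualSpace φ, sliceLeft εB (T₁ (b ⊗ₜ b')) = hφ.dualMul b b') ∧
    (∀ b b' : dualSpace φ, sliceRight εB (T₂ (b ⊗ₜ b')) = hφ.dualMul b b') ∧
    (∀ b b' : dualSpace φ, hφ.dualMulTensor
      (TensorProduct.map SB.toLinearMap LinearMap.id (T₁ (b ⊗ₜ b'))) = εB b • b') ∧
    (∀ b b' : dualSpace φ, hφ.dualMulTensor
      (TensorProduct.map LinearMap.id SB.toLinearMap (T₂ (b ⊗ₜ b'))) = εB b' • b)

end RegularMultiplierHopfAlgebra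

/-- The right integral `ψ = φ ∘ S` associated with the left integral `φ`. -/
def rightIntegral {A : Type*} [NonUnitalRing A] [Module ℂ A] (φ : Module.Dual ℂ A)
    (S : A ≃ₗ[ℂ] A) : Module.Dual ℂ A := φ ∘ₗ S.toLinearMap

end MHA

end

/-! Write $F(a)=\varphi(\,\cdot\,a)$ and $G(a)=\psi(S(\,\cdot\,)a)$. Both inversion formulas rest on
strong left invariance, $S((\iota\otimes\varphi)(\Delta(p)(1\otimes
q)))=(\iota\otimes\varphi)((1\otimes p)\Delta(q))$, which is `IsIntegral.antipode_sliceRight`. It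
yields two product formulas in $B$: $S(F(c))F(a)=F((\varphi\otimes\iota)(\Delta(a)(c\otimes1)))$
(`dualMul_comp_antipode`) and $F(c)G(a)=G((\iota\otimes\varphi)(\Delta(a)(1\otimes c)))$
(`dualMul_rightTranslate`). The functionals $\widehat\psi=\varepsilon\circ F^{-1}$ and
$\widehat\varphi=\varepsilon\circ G^{-1}$ collapse the right-hand sides through the counit to
$\varphi(ac)=\langle a,F(c)\rangle$. Since $F$ is onto $B$ and $\varphi$ is faithful, these values
determine $a$.

The counit comes from coassociativity and the bijectivity of $T_1$ and $T_2$ alone. The antipode is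
obtained from $\varphi$: the map $(\varepsilon\otimes\iota)T_1^{-1}$ must be $a\otimes b\mapsto
S(a)b$, and invariance shows that it is left multiplication by an element. Anti-comultiplicativity
of $S$ (`IsAntipode.map_T₁`) makes $\psi$ a right integral. Comparing $\varphi$ with $\psi$ shows
that the functionals $\varphi(\,\cdot\,a)$, $\psi(v\,\cdot\,)$ and $\psi(S(\,\cdot\,)a)$ fill the
same space $B$, stable under composition with $S$ (`exists_equivs`).

For the antipode of $B$, the dual maps $T_1$ and $T_2$ are computed from $T_3^{-1}$ and $T_4^{-1}$
of $A$, and the counit of $B$ is evaluation at the missing unit. The antipode axioms then reduce to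
the same product formulas, and non-degeneracy gives uniqueness (`isDualAntipode_iff`).

All arguments about $A$ use only the four maps and the product, collected in `HopfData`. Its axioms
are stable under passing to the opposite algebra, with or without flipping the coproduct, so each
fact is proved on one side and transported. -/

noncomputable section

namespace MHA

/-! ### Linear algebra on tensor legs and slices. -/

section Legs

variable {V V' V'' W W' : Type*} [AddCommGroup V] [Module ℂ V] [AddCommGroup V'] [Module ℂ V']
  [AddCommGroup V''] [Module ℂ V''] [AddCommGroup W] [Module ℂ W] [AddCommGroup W'] [Module ℂ W']

/-- The map `f ⊗ ι`. -/
abbrev onFst (f : V →ₗ[ℂ] V') : V ⊗[ℂ] W →ₗ[ℂ] V' ⊗[ℂ] W := TensorProduct.map f LinearMap.id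

/-- The map `ι ⊗ g`. -/
abbrev onSnd (g : W →ₗ[ℂ] W') : V ⊗[ℂ] W →ₗ[ℂ] V ⊗[ℂ] W' := TensorProduct.map LinearMap.id g

/-- The map `b ↦ T (a ⊗ b)`. -/
abbrev fixFst (T : V ⊗[ℂ] W →ₗ[ℂ] V') (a : V) : W →ₗ[ℂ] V' := T ∘ₗ TensorProduct.mk ℂ V W a

/-- The map `a ↦ T (a ⊗ b)`. -/
abbrev fixSnd (T : V ⊗[ℂ] W →ₗ[ℂ] V') (b : W) : V →ₗ[ℂ] V' :=
  T ∘ₗ (TensorProduct.mk ℂ V W).flip b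

/-- The flip of the two factors. -/
abbrev flipMap (V : Type*) [AddCommGroup V] [Module ℂ V] : V ⊗[ℂ] V →ₗ[ℂ] V ⊗[ℂ] V :=
  (TensorProduct.comm ℂ V V).toLinearMap

/-- This replaces Sweedler notation: an identity is checked on elements such as $\Delta(a)(1\otimes
b)$, and bijectivity of $T$ extends it to all tensors. -/
theorem linearMap_ext_of_equiv (T : V ⊗[ℂ] W ≃ₗ[ℂ] V') {f g : V' →ₗ[ℂ] V''}
    (h : ∀ a b, f (T (a ⊗ₜ b)) = g (T (a ⊗ₜ b))) (z : V') : f z = g z := by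
  have h' : f ∘ₗ T.toLinearMap = g ∘ₗ T.toLinearMap := TensorProduct.ext' h
  simpa using LinearMap.congr_fun h' (T.symm z)

/-- Expanding along a basis of the first leg reduces the claim to the coefficients in $W$. It is
used to cancel multiplications on one leg. -/
theorem onSnd_injective {ι : Type*} (g : ι → W →ₗ[ℂ] W') (hg : ∀ w, (∀ i, g i w = 0) → w = 0)
    {z z' : V ⊗[ℂ] W} (h : ∀ i, onSnd (g i) z = onSnd (g i) z') : z = z' := by
  classical
  let e := Module.Basis.ofVectorSpace ℂ V
  rw [← sub_eq_zero]
  apply (TensorProduct.equivFinsuppOfBasisLeft (N := W) e).injective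
  rw [map_zero]
  ext k
  refine hg _ fun i => ?_
  have key : ∀ z : V ⊗[ℂ] W, g i (TensorProduct.equivFinsuppOfBasisLeft e z k) =
      TensorProduct.equivFinsuppOfBasisLeft e (onSnd (g i) z) k := by
    intro z
    induction z with
    | zero => simp
    | add x y hx hy => simp only [map_add, Finsupp.add_apply, hx, hy]
    | tmul a b => simp [TensorProduct.equivFinsuppOfBasisLeft_apply_tmul]
  rw [key, map_sub, h, sub_self]
  simp

theorem onFst_injective {ι : Type*} (g : ι → V →ₗ[ℂ] V') (hg : ∀ w, (∀ i, g i w = 0) → w = 0)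
    {z z' : V ⊗[ℂ] W} (h : ∀ i, onFst (g i) z = onFst (g i) z') : z = z' := by
  apply (TensorProduct.comm ℂ V W).injective
  refine onSnd_injective g hg fun i => ?_
  have key : ∀ z : V ⊗[ℂ] W, onSnd (g i) (TensorProduct.comm ℂ V W z) =
      TensorProduct.comm ℂ V' W (onFst (g i) z) := by
    intro z
    induction z with
    | zero => simp
    | add x y hx hy => simp only [map_add, hx, hy]
    | tmul a b => simp
  rw [key, key, h]

theorem onFst_onFst (f : V' →ₗ[ℂ] V'') (g : V →ₗ[ℂ] V') (z : V ⊗[ℂ] W) :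
    onFst f (onFst g z) = onFst (f ∘ₗ g) z := by
  rw [TensorProduct.map_map]; rfl

theorem onSnd_onSnd (f : V' →ₗ[ℂ] V'') (g : V →ₗ[ℂ] V') (z : W ⊗[ℂ] V) :
    onSnd f (onSnd g z) = onSnd (f ∘ₗ g) z := by
  rw [TensorProduct.map_map]; rfl

theorem onFst_onSnd (f : V →ₗ[ℂ] V') (g : W →ₗ[ℂ] W') (z : V ⊗[ℂ] W) :
    onFst f (onSnd g z) = onSnd g (onFst f z) := by
  rw [TensorProduct.map_map, TensorProduct.map_map]; rfl

theorem onFst_assoc (f : V →ₗ[ℂ] V') (z : (V ⊗[ℂ] W) ⊗[ℂ] W') :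
    onFst f (TensorProduct.assoc ℂ V W W' z) =
      TensorProduct.assoc ℂ V' W W' (onFst (onFst f) z) := by
  rw [← TensorProduct.map_map_assoc]; simp

theorem onSnd_onFst_assoc (f : W →ₗ[ℂ] W') (z : (V ⊗[ℂ] W) ⊗[ℂ] V') :
    onSnd (onFst f) (TensorProduct.assoc ℂ V W V' z) =
      TensorProduct.assoc ℂ V W' V' (onFst (onSnd f) z) := by
  rw [← TensorProduct.map_map_assoc]

theorem onSnd_onSnd_assoc (f : W' →ₗ[ℂ] V') (z : (V ⊗[ℂ] W) ⊗[ℂ] W') :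
    onSnd (onSnd f) (TensorProduct.assoc ℂ V W W' z) =
      TensorProduct.assoc ℂ V W V' (onSnd f z) := by
  have := TensorProduct.map_map_assoc (LinearMap.id : V →ₗ[ℂ] V) (LinearMap.id : W →ₗ[ℂ] W) f z
  rwa [TensorProduct.map_id] at this

theorem sliceLeft_map (ω : Module.Dual ℂ W) (f g : V →ₗ[ℂ] W) (z : V ⊗[ℂ] V) :
    sliceLeft ω (TensorProduct.map f g z) = g (sliceLeft (ω ∘ₗ f) z) := by
  induction z with
  | zero => simp
  | add x y hx hy => simp only [map_add, hx, hy]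
  | tmul a b => simp

theorem sliceRight_map (ω : Module.Dual ℂ W) (f g : V →ₗ[ℂ] W) (z : V ⊗[ℂ] V) :
    sliceRight ω (TensorProduct.map f g z) = f (sliceRight (ω ∘ₗ g) z) := by
  induction z with
  | zero => simp
  | add x y hx hy => simp only [map_add, hx, hy]
  | tmul a b => simp

theorem sliceLeft_comm (ω : Module.Dual ℂ V) (z : V ⊗[ℂ] V) :
    sliceLeft ω (TensorProduct.comm ℂ V V z) = sliceRight ω z := by
  induction z with
  | zero => simp
  | add x y hx hy => simp only [map_add, hx, hy]
  | tmul a b => simp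

theorem sliceRight_comm (ω : Module.Dual ℂ V) (z : V ⊗[ℂ] V) :
    sliceRight ω (TensorProduct.comm ℂ V V z) = sliceLeft ω z := by
  induction z with
  | zero => simp
  | add x y hx hy => simp only [map_add, hx, hy]
  | tmul a b => simp

theorem apply_sliceLeft (ω ω' : Module.Dual ℂ V) (z : V ⊗[ℂ] V) :
    ω' (sliceLeft ω z) = ω (sliceRight ω' z) := by
  induction z with
  | zero => simp
  | add x y hx hy => simp only [map_add, hx, hy]
  | tmul a b => simp [mul_comm]

theorem exists_apply_eq_one {ω : Module.Dual ℂ V} (hω : ω ≠ 0) : ∃ v, ω v = 1 := by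
  obtain ⟨v, hv⟩ : ∃ v, ω v ≠ 0 := by
    by_contra! h
    exact hω (LinearMap.ext h)
  exact ⟨(ω v)⁻¹ • v, by simp [hv]⟩

theorem sliceRight_surjective {ω : Module.Dual ℂ V} (hω : ω ≠ 0) :
    Function.Surjective (sliceRight ω) := fun a => by
  obtain ⟨v, hv⟩ := exists_apply_eq_one hω
  exact ⟨a ⊗ₜ v, by simp [hv]⟩

theorem sliceLeft_surjective {ω : Module.Dual ℂ V} (hω : ω ≠ 0) :
    Function.Surjective (sliceLeft ω) := fun a => by
  obtain ⟨v, hv⟩ := exists_apply_eq_one hω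
  exact ⟨v ⊗ₜ a, by simp [hv]⟩

/-- Reversing the order of the three legs turns one coassociativity law into the other. -/
theorem assoc_onFst_flip {f g : V →ₗ[ℂ] V ⊗[ℂ] V} {x y : V ⊗[ℂ] V}
    (h : TensorProduct.assoc ℂ V V V (onFst f x) = onSnd g y) :
    TensorProduct.assoc ℂ V V V (onFst (flipMap V ∘ₗ g) (flipMap V y)) =
      onSnd (flipMap V ∘ₗ f) (flipMap V x) := by
  let τ : V ⊗[ℂ] (V ⊗[ℂ] V) →ₗ[ℂ] V ⊗[ℂ] (V ⊗[ℂ] V) :=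
    (TensorProduct.assoc ℂ V V V).toLinearMap ∘ₗ
      (TensorProduct.comm ℂ V (V ⊗[ℂ] V)).toLinearMap ∘ₗ onSnd (flipMap V)
  have hτ : ∀ a b c : V, τ (a ⊗ₜ (b ⊗ₜ c)) = c ⊗ₜ (b ⊗ₜ a) := fun a b c => by simp [τ]
  have k₁ : ∀ y : V ⊗[ℂ] V, TensorProduct.assoc ℂ V V V
      (onFst (flipMap V ∘ₗ g) (flipMap V y)) = τ (onSnd g y) := by
    intro y
    induction y with
    | zero => simp
    | add x y hx hy => simp only [map_add, hx, hy]
    | tmul a b =>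
      simp only [LinearEquiv.coe_coe, TensorProduct.comm_tmul, TensorProduct.map_tmul,
        LinearMap.comp_apply, LinearMap.id_apply]
      generalize g b = w
      induction w with
      | zero => simp
      | add x y hx hy => simp only [map_add, TensorProduct.tmul_add, TensorProduct.add_tmul, hx, hy]
      | tmul p q => simp [hτ]
  have k₂ : ∀ x : V ⊗[ℂ] V, onSnd (flipMap V ∘ₗ f) (flipMap V x) =
      τ (TensorProduct.assoc ℂ V V V (onFst f x)) := by
    intro x
    induction x with
    | zero => simp
    | add x y hx hy => simp only [map_add, hx, hy]
    | tmul a b =>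
      simp only [LinearEquiv.coe_coe, TensorProduct.comm_tmul, TensorProduct.map_tmul,
        LinearMap.comp_apply, LinearMap.id_apply]
      generalize f a = w
      induction w with
      | zero => simp
      | add x y hx hy => simp only [map_add, TensorProduct.tmul_add, TensorProduct.add_tmul, hx, hy]
      | tmul p q => simp [hτ]
  rw [k₁, k₂, h]

end Legs

/-! ### The axioms in terms of the four maps, and their symmetries. -/

/-- A regular multiplier Hopf algebra in terms of its bilinear product `m`, the four maps
`T₁ (a ⊗ b) = Δ(a)(1 ⊗ b)`, `T₂ (a ⊗ b) = (a ⊗ 1)Δ(b)`, `T₃ (a ⊗ b) = Δ(a)(b ⊗ 1)`,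
`T₄ (a ⊗ b) = (1 ⊗ a)Δ(b)` and the maps `dl a z = Δ(a)z`, `dr a z = zΔ(a)`. -/
structure HopfData (V : Type*) [AddCommGroup V] [Module ℂ V] where
  m : V →ₗ[ℂ] V →ₗ[ℂ] V
  assoc : ∀ a b c, m (m a b) c = m a (m b c)
  nondeg_left : ∀ a, (∀ b, m a b = 0) → a = 0
  nondeg_right : ∀ b, (∀ a, m a b = 0) → b = 0
  T₁ : V ⊗[ℂ] V ≃ₗ[ℂ] V ⊗[ℂ] V
  T₂ : V ⊗[ℂ] V ≃ₗ[ℂ] V ⊗[ℂ] V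
  T₃ : V ⊗[ℂ] V ≃ₗ[ℂ] V ⊗[ℂ] V
  T₄ : V ⊗[ℂ] V ≃ₗ[ℂ] V ⊗[ℂ] V
  dl : V → V ⊗[ℂ] V →ₗ[ℂ] V ⊗[ℂ] V
  dr : V → V ⊗[ℂ] V →ₗ[ℂ] V ⊗[ℂ] V
  dl_eq_T₁ : ∀ a x y, dl a (x ⊗ₜ y) = onFst (m.flip x) (T₁ (a ⊗ₜ y))
  dl_eq_T₃ : ∀ a x y, dl a (x ⊗ₜ y) = onSnd (m.flip y) (T₃ (a ⊗ₜ x))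
  dr_eq_T₂ : ∀ a x y, dr a (x ⊗ₜ y) = onSnd (m y) (T₂ (x ⊗ₜ a))
  dr_eq_T₄ : ∀ a x y, dr a (x ⊗ₜ y) = onFst (m x) (T₄ (y ⊗ₜ a))
  dl_T₁ : ∀ a b c, dl a (T₁ (b ⊗ₜ c)) = T₁ (m a b ⊗ₜ c)
  dl_T₃ : ∀ a b c, dl a (T₃ (b ⊗ₜ c)) = T₃ (m a b ⊗ₜ c)
  dr_T₂ : ∀ a b c, dr a (T₂ (b ⊗ₜ c)) = T₂ (b ⊗ₜ m c a)
  dr_T₄ : ∀ a b c, dr a (T₄ (b ⊗ₜ c)) = T₄ (b ⊗ₜ m c a)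
  T₁_T₂ : ∀ a b c, onFst (m a) (T₁ (b ⊗ₜ c)) = onSnd (m.flip c) (T₂ (a ⊗ₜ b))
  T₃_T₄ : ∀ a b c, onSnd (m a) (T₃ (b ⊗ₜ c)) = onFst (m.flip c) (T₄ (a ⊗ₜ b))
  T₃_T₂ : ∀ a b c, onFst (m a) (T₃ (b ⊗ₜ c)) = onFst (m.flip c) (T₂ (a ⊗ₜ b))
  T₁_T₄ : ∀ a b c, onSnd (m a) (T₁ (b ⊗ₜ c)) = onSnd (m.flip c) (T₄ (a ⊗ₜ b))
  coassoc : ∀ a b c, TensorProduct.assoc ℂ V V V (onFst (fixFst T₂.toLinearMap a) (T₁ (b ⊗ₜ c)))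
    = onSnd (fixSnd T₁.toLinearMap c) (T₂ (a ⊗ₜ b))
  coassoc' : ∀ a b c, TensorProduct.assoc ℂ V V V (onFst (fixSnd T₃.toLinearMap a) (T₄ (c ⊗ₜ b)))
    = onSnd (fixFst T₄.toLinearMap c) (T₃ (b ⊗ₜ a))

namespace HopfData

variable {V : Type*} [AddCommGroup V] [Module ℂ V] (H : HopfData V)

/-- The same coproduct on the opposite algebra. -/
def op : HopfData V where
  m := H.m.flip
  assoc a b c := (H.assoc c b a).symm
  nondeg_left := H.nondeg_right
  nondeg_right := H.nondeg_left
  T₁ := TensorProduct.comm ℂ V V ≪≫ₗ H.T₄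
  T₂ := TensorProduct.comm ℂ V V ≪≫ₗ H.T₃
  T₃ := TensorProduct.comm ℂ V V ≪≫ₗ H.T₂
  T₄ := TensorProduct.comm ℂ V V ≪≫ₗ H.T₁
  dl := H.dr
  dr := H.dl
  dl_eq_T₁ := H.dr_eq_T₄
  dl_eq_T₃ := H.dr_eq_T₂
  dr_eq_T₂ := H.dl_eq_T₃
  dr_eq_T₄ := H.dl_eq_T₁
  dl_T₁ a b c := H.dr_T₄ a c b
  dl_T₃ a b c := H.dr_T₂ a c b
  dr_T₂ a b c := H.dl_T₃ a c b
  dr_T₄ a b c := H.dl_T₁ a c b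
  T₁_T₂ a b c := (H.T₃_T₄ c b a).symm
  T₃_T₄ a b c := (H.T₁_T₂ c b a).symm
  T₃_T₂ a b c := (H.T₃_T₂ c b a).symm
  T₁_T₄ a b c := (H.T₁_T₄ c b a).symm
  coassoc a b c := H.coassoc' a b c
  coassoc' a b c := H.coassoc a b c

/-- The opposite algebra with the opposite coproduct. -/
def opCoop : HopfData V where
  m := H.m.flip
  assoc a b c := (H.assoc c b a).symm
  nondeg_left := H.nondeg_right
  nondeg_right := H.nondeg_left
  T₁ := TensorProduct.comm ℂ V V ≪≫ₗ H.T₂ ≪≫ₗ TensorProduct.comm ℂ V V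
  T₂ := TensorProduct.comm ℂ V V ≪≫ₗ H.T₁ ≪≫ₗ TensorProduct.comm ℂ V V
  T₃ := TensorProduct.comm ℂ V V ≪≫ₗ H.T₄ ≪≫ₗ TensorProduct.comm ℂ V V
  T₄ := TensorProduct.comm ℂ V V ≪≫ₗ H.T₃ ≪≫ₗ TensorProduct.comm ℂ V V
  dl a := flipMap V ∘ₗ H.dr a ∘ₗ flipMap V
  dr a := flipMap V ∘ₗ H.dl a ∘ₗ flipMap V
  dl_eq_T₁ a x y := by simp [H.dr_eq_T₂, TensorProduct.map_comm]
  dl_eq_T₃ a x y := by simp [H.dr_eq_T₄, TensorProduct.map_comm]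
  dr_eq_T₂ a x y := by simp [H.dl_eq_T₁, TensorProduct.map_comm]
  dr_eq_T₄ a x y := by simp [H.dl_eq_T₃, TensorProduct.map_comm]
  dl_T₁ a b c := by simp [H.dr_T₂]
  dl_T₃ a b c := by simp [H.dr_T₄]
  dr_T₂ a b c := by simp [H.dl_T₁]
  dr_T₄ a b c := by simp [H.dl_T₃]
  T₁_T₂ a b c := by simpa [TensorProduct.map_comm] using (H.T₁_T₂ c b a).symm
  T₃_T₄ a b c := by simpa [TensorProduct.map_comm] using (H.T₃_T₄ c b a).symm
  T₃_T₂ a b c := by simpa [TensorProduct.map_comm] using (H.T₁_T₄ c b a).symm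
  T₁_T₄ a b c := by simpa [TensorProduct.map_comm] using (H.T₃_T₂ c b a).symm
  coassoc a b c :=
    assoc_onFst_flip (f := fixFst H.T₂.toLinearMap c) (g := fixSnd H.T₁.toLinearMap a)
      (x := H.T₁ (b ⊗ₜ a)) (y := H.T₂ (c ⊗ₜ b)) (H.coassoc c b a)
  coassoc' a b c :=
    assoc_onFst_flip (f := fixSnd H.T₃.toLinearMap c) (g := fixFst H.T₄.toLinearMap a)
      (x := H.T₄ (a ⊗ₜ b)) (y := H.T₃ (b ⊗ₜ c)) (H.coassoc' c b a)

end HopfData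

/-! ### The counit. -/

namespace HopfData

variable {V : Type*} [AddCommGroup V] [Module ℂ V] (H : HopfData V)

/-- The map `b ⊗ c ↦ ((a ⊗ 1)Δ(b)) ⊗ c`. -/
def coverLeft (a : V) : V ⊗[ℂ] V →ₗ[ℂ] V ⊗[ℂ] (V ⊗[ℂ] V) :=
  (TensorProduct.assoc ℂ V V V).toLinearMap ∘ₗ onFst (fixFst H.T₂.toLinearMap a)

theorem onSnd_assoc_tmul {X : Type*} [AddCommGroup X] [Module ℂ X] (f : V ⊗[ℂ] V →ₗ[ℂ] X)
    (z : V ⊗[ℂ] V) (c : V) :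
    onSnd f (TensorProduct.assoc ℂ V V V (z ⊗ₜ c)) = onSnd (fixSnd f c) z := by
  induction z with
  | zero => simp
  | add x y hx hy => simp only [map_add, TensorProduct.add_tmul, hx, hy]
  | tmul a b => simp

theorem onSnd_coverLeft_tmul {X : Type*} [AddCommGroup X] [Module ℂ X]
    (f : V ⊗[ℂ] V →ₗ[ℂ] X) (a b c : V) :
    onSnd f (H.coverLeft a (b ⊗ₜ c)) = onSnd (fixSnd f c) (H.T₂ (a ⊗ₜ b)) := by
  simp only [coverLeft, LinearMap.comp_apply, TensorProduct.map_tmul, LinearEquiv.coe_coe]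
  exact onSnd_assoc_tmul f _ c

/-- Coassociativity as an intertwining relation. In this form it passes to $T_1^{-1}$, which is how
the counit and the antipode are reached. -/
theorem coverLeft_T₁ (a : V) (w : V ⊗[ℂ] V) :
    H.coverLeft a (H.T₁ w) = onSnd H.T₁.toLinearMap (H.coverLeft a w) := by
  have h : H.coverLeft a ∘ₗ H.T₁.toLinearMap = onSnd H.T₁.toLinearMap ∘ₗ H.coverLeft a := by
    refine TensorProduct.ext' fun b c => ?_
    simp only [LinearMap.comp_apply]
    rw [onSnd_coverLeft_tmul, ← H.coassoc]
    rfl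
  exact LinearMap.congr_fun h w

theorem onSnd_T₁_symm_coverLeft (a : V) (z : V ⊗[ℂ] V) :
    onSnd H.T₁.symm.toLinearMap (H.coverLeft a z) = H.coverLeft a (H.T₁.symm z) := by
  obtain ⟨w, rfl⟩ := H.T₁.surjective z
  rw [coverLeft_T₁, onSnd_onSnd]
  simp

theorem onSnd_lift_coverLeft (a : V) (w : V ⊗[ℂ] V) :
    onSnd (TensorProduct.lift H.m) (H.coverLeft a w) = onFst (H.m a) (H.T₁ w) := by
  have h : onSnd (TensorProduct.lift H.m) ∘ₗ H.coverLeft a =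
      onFst (H.m a) ∘ₗ H.T₁.toLinearMap := by
    refine TensorProduct.ext' fun b c => ?_
    simp only [LinearMap.comp_apply, LinearEquiv.coe_coe]
    rw [onSnd_coverLeft_tmul, H.T₁_T₂]
    congr 2
  exact LinearMap.congr_fun h w

/-- `ε` is a counit. -/
def IsCounit (ε : Module.Dual ℂ V) : Prop :=
  (∀ a b, sliceLeft ε (H.T₁ (a ⊗ₜ b)) = H.m a b) ∧
    ∀ a b, sliceRight ε (H.T₂ (a ⊗ₜ b)) = H.m a b

/-- A counit must satisfy $\varepsilon\otimes\iota=m\,T_1^{-1}$ and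
$\iota\otimes\varepsilon=m\,T_2^{-1}$. Coassociativity relates the two right-hand sides, and this
relation forces both to be slices by one functional. -/
theorem exists_isCounit [Nontrivial V] : ∃ ε, H.IsCounit ε := by
  let μ : V ⊗[ℂ] V →ₗ[ℂ] V := TensorProduct.lift H.m
  let E₁ : V ⊗[ℂ] V →ₗ[ℂ] V := μ ∘ₗ H.T₁.symm.toLinearMap
  let E₂ : V ⊗[ℂ] V →ₗ[ℂ] V := μ ∘ₗ H.T₂.symm.toLinearMap
  -- At $x=u\otimes y$ this reads $u\otimes E_1(y\otimes c)=E_2(u\otimes y)\otimes c$, so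
  -- $E_1(y\otimes c)$ is a multiple of $c$ with a factor depending only on $y$.
  have key (c : V) (x : V ⊗[ℂ] V) : onSnd (fixSnd E₁ c) x = E₂ x ⊗ₜ c := by
    have := linearMap_ext_of_equiv H.T₂ (f := onSnd (fixSnd E₁ c))
      (g := (TensorProduct.mk ℂ V V).flip c ∘ₗ E₂) (fun a b => ?_) x
    · exact this
    · rw [← onSnd_coverLeft_tmul, ← onSnd_onSnd, onSnd_T₁_symm_coverLeft, onSnd_lift_coverLeft]
      simp [E₂, μ]
  obtain ⟨u, hu⟩ := exists_ne (0 : V)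
  obtain ⟨ω', hω'⟩ : ∃ ω : Module.Dual ℂ V, ω u ≠ 0 := by
    by_contra! h
    exact hu ((Module.forall_dual_apply_eq_zero_iff ℂ u).1 h)
  obtain ⟨ω, hω⟩ : ∃ ω : Module.Dual ℂ V, ω u = 1 := ⟨(ω' u)⁻¹ • ω', by simp [hω']⟩
  let ε : Module.Dual ℂ V := ω ∘ₗ fixFst E₂ u
  have h₁ (y c : V) : E₁ (y ⊗ₜ c) = ε y • c := by
    simpa [hω, ε] using congrArg (sliceLeft ω) (key c (u ⊗ₜ y))
  have h₂ (x y : V) : E₂ (x ⊗ₜ y) = ε y • x := by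
    have := congrArg (sliceRight ω) (key u (x ⊗ₜ y))
    simp only [TensorProduct.map_tmul, LinearMap.id_apply, LinearMap.comp_apply,
      LinearMap.flip_apply, TensorProduct.mk_apply, h₁, sliceRight_tmul, map_smul, hω, one_smul,
      smul_eq_mul, mul_one] at this
    exact this.symm
  have h₁' : sliceLeft ε = E₁ := TensorProduct.ext' fun y c => by simp [h₁]
  have h₂' : sliceRight ε = E₂ := TensorProduct.ext' fun y c => by simp [h₂]
  refine ⟨ε, fun a b => ?_, fun a b => ?_⟩
  · simp [h₁', E₁, μ]
  · simp [h₂', E₂, μ]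

variable {H} {ε : Module.Dual ℂ V}

theorem IsCounit.opCoop (hε : H.IsCounit ε) : H.opCoop.IsCounit ε := by
  refine ⟨fun a b => ?_, fun a b => ?_⟩
  · simp [HopfData.opCoop, sliceLeft_comm, hε.2]
  · simp [HopfData.opCoop, sliceRight_comm, hε.1]

theorem IsCounit.ne_zero [Nontrivial V] (hε : H.IsCounit ε) : ε ≠ 0 := by
  rintro rfl
  obtain ⟨u, hu⟩ := exists_ne (0 : V)
  refine hu (H.nondeg_left u fun b => ?_)
  rw [← hε.1]
  simp [sliceLeft]

theorem IsCounit.eq_of_sliceLeft [Nontrivial V] (hε : H.IsCounit ε) {ε' : Module.Dual ℂ V}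
    (h : ∀ a b, sliceLeft ε' (H.T₁ (a ⊗ₜ b)) = H.m a b) : ε' = ε := by
  obtain ⟨u, hu⟩ := exists_ne (0 : V)
  ext a
  have := linearMap_ext_of_equiv H.T₁ (f := sliceLeft ε') (g := sliceLeft ε)
    (fun a b => by rw [h, hε.1]) (a ⊗ₜ u)
  simpa [hu] using this

theorem IsCounit.sliceLeft_dl (hε : H.IsCounit ε) (a : V) (z : V ⊗[ℂ] V) :
    sliceLeft ε (H.dl a z) = H.m a (sliceLeft ε z) :=
  linearMap_ext_of_equiv H.T₁ (f := sliceLeft ε ∘ₗ H.dl a) (g := H.m a ∘ₗ sliceLeft ε)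
    (fun b c => by simp [H.dl_T₁, hε.1, H.assoc]) z

/-- Computing $(\varepsilon\otimes\iota)(\Delta(p)(b\otimes q))$ by `sliceLeft_dl` gives
$\varepsilon(b)\,pq$. Hence the slices by $\varepsilon(\,\cdot\,b)$ and by
$\varepsilon(b)\varepsilon$ agree on the range of $T_1$, which is everything. -/
theorem IsCounit.map_mul [Nontrivial V] (hε : H.IsCounit ε) (a b : V) :
    ε (H.m a b) = ε a * ε b := by
  obtain ⟨u, hu⟩ := exists_ne (0 : V)
  have := linearMap_ext_of_equiv H.T₁ (f := sliceLeft (ε ∘ₗ H.m.flip b)) (g := ε b • sliceLeft ε)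
    (fun p q => by
      have h := sliceLeft_map ε (H.m.flip b) LinearMap.id (H.T₁ (p ⊗ₜ q))
      rw [LinearMap.id_apply] at h
      rw [← h, ← H.dl_eq_T₁, hε.sliceLeft_dl]
      simp [hε.1]) (a ⊗ₜ u)
  simpa [smul_smul, hu, mul_comm] using this

theorem IsCounit.comp_mulRight [Nontrivial V] (hε : H.IsCounit ε) (c : V) :
    ε ∘ₗ H.m.flip c = ε c • ε := by
  ext a
  simp [hε.map_mul, mul_comm]

theorem sliceLeft_onSnd (ω : Module.Dual ℂ V) (g : V →ₗ[ℂ] V) (z : V ⊗[ℂ] V) :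
    sliceLeft ω (onSnd g z) = g (sliceLeft ω z) := sliceLeft_map ω _ g z

theorem sliceLeft_onFst (ω : Module.Dual ℂ V) (f : V →ₗ[ℂ] V) (z : V ⊗[ℂ] V) :
    sliceLeft ω (onFst f z) = sliceLeft (ω ∘ₗ f) z := sliceLeft_map ω f _ z

theorem sliceRight_onFst (ω : Module.Dual ℂ V) (f : V →ₗ[ℂ] V) (z : V ⊗[ℂ] V) :
    sliceRight ω (onFst f z) = f (sliceRight ω z) := sliceRight_map ω f _ z

theorem sliceRight_onSnd (ω : Module.Dual ℂ V) (g : V →ₗ[ℂ] V) (z : V ⊗[ℂ] V) :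
    sliceRight ω (onSnd g z) = sliceRight (ω ∘ₗ g) z := sliceRight_map ω _ g z

theorem IsCounit.sliceLeft_T₃ (hε : H.IsCounit ε) (a x : V) :
    sliceLeft ε (H.T₃ (a ⊗ₜ x)) = ε x • a := by
  rw [← sub_eq_zero]
  refine H.nondeg_left _ fun y => ?_
  have := hε.sliceLeft_dl a (x ⊗ₜ y)
  rw [H.dl_eq_T₃, sliceLeft_onSnd] at this
  simpa [sub_eq_zero] using this

theorem IsCounit.sliceLeft_T₄ [Nontrivial V] (hε : H.IsCounit ε) (a b : V) :
    sliceLeft ε (H.T₄ (a ⊗ₜ b)) = H.m a b := by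
  -- Under $\varepsilon$, this $c$ plays the role of the missing unit in $(1\otimes
  -- a)\Delta(b)(c\otimes1)$.
  obtain ⟨c, hc⟩ := exists_apply_eq_one hε.ne_zero
  have := congrArg (sliceLeft ε) (H.T₃_T₄ a b c)
  rw [sliceLeft_onSnd, hε.sliceLeft_T₃, sliceLeft_onFst, hε.comp_mulRight, hc, one_smul,
    one_smul] at this
  exact this.symm

theorem IsCounit.sliceRight_T₃ [Nontrivial V] (hε : H.IsCounit ε) (a b : V) :
    sliceRight ε (H.T₃ (a ⊗ₜ b)) = H.m a b := by
  have := hε.opCoop.sliceLeft_T₄ b a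
  simpa [HopfData.opCoop, sliceLeft_comm] using this

theorem IsCounit.op [Nontrivial V] (hε : H.IsCounit ε) : H.op.IsCounit ε :=
  ⟨fun a b => hε.sliceLeft_T₄ b a, fun a b => hε.sliceRight_T₃ b a⟩

theorem IsCounit.sliceRight_T₁ [Nontrivial V] (hε : H.IsCounit ε) (a x : V) :
    sliceRight ε (H.T₁ (a ⊗ₜ x)) = ε x • a := by
  have := hε.op.opCoop.sliceLeft_T₃ a x
  simpa [HopfData.opCoop, HopfData.op, sliceLeft_comm] using this

end HopfData

/-! ### Covered coassociativity, strong invariance and the antipode. -/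

namespace HopfData

variable {V : Type*} [AddCommGroup V] [Module ℂ V] (H : HopfData V)

/-- The element `(Δ ⊗ ι)(Δ(p))(1 ⊗ x ⊗ y)`. -/
def iterated (p x y : V) : V ⊗[ℂ] (V ⊗[ℂ] V) :=
  TensorProduct.assoc ℂ V V V (onFst (fixSnd H.T₁.toLinearMap x) (H.T₁ (p ⊗ₜ y)))

/-- The map `x ⊗ y ↦ (Δ ⊗ ι)(Δ(p))(1 ⊗ x ⊗ y)`. -/
def iteratedMap (p : V) : V ⊗[ℂ] V →ₗ[ℂ] V ⊗[ℂ] (V ⊗[ℂ] V) :=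
  TensorProduct.lift (LinearMap.mk₂ ℂ (H.iterated p)
    (fun x x' y => by
      simp [iterated, fixSnd, TensorProduct.map_add_left, LinearMap.comp_add])
    (fun r x y => by
      simp [iterated, fixSnd, TensorProduct.map_smul_left, LinearMap.comp_smul])
    (fun x y y' => by simp [iterated, TensorProduct.tmul_add])
    (fun r x y => by simp [iterated]))

@[simp] theorem iteratedMap_tmul (p x y : V) : H.iteratedMap p (x ⊗ₜ y) =
    TensorProduct.assoc ℂ V V V (onFst (fixSnd H.T₁.toLinearMap x) (H.T₁ (p ⊗ₜ y))) := by
  rw [iteratedMap, TensorProduct.lift.tmul]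
  rfl

theorem dl_add (a b : V) (z : V ⊗[ℂ] V) : H.dl (a + b) z = H.dl a z + H.dl b z := by
  induction z with
  | zero => simp
  | add x y hx hy => simp only [map_add, hx, hy]; abel
  | tmul x y => simp [H.dl_eq_T₁, TensorProduct.add_tmul]

theorem dl_smul (r : ℂ) (a : V) (z : V ⊗[ℂ] V) : H.dl (r • a) z = r • H.dl a z := by
  induction z with
  | zero => simp
  | add x y hx hy => simp only [map_add, hx, hy, smul_add]
  | tmul x y => rw [H.dl_eq_T₁, H.dl_eq_T₁, ← TensorProduct.smul_tmul', map_smul, map_smul]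

/-- `a ↦ Δ(a)z`. -/
def dlAt (z : V ⊗[ℂ] V) : V →ₗ[ℂ] V ⊗[ℂ] V where
  toFun a := H.dl a z
  map_add' a b := H.dl_add a b z
  map_smul' r a := H.dl_smul r a z

theorem dlAt_T₃ (q b : V) : H.dlAt (H.T₃ (q ⊗ₜ b)) = fixSnd H.T₃.toLinearMap b ∘ₗ H.m.flip q := by
  ext a
  simp [dlAt, H.dl_T₃]

theorem dlAt_add (z z' : V ⊗[ℂ] V) : H.dlAt (z + z') = H.dlAt z + H.dlAt z' := by
  ext a
  simp [dlAt]

theorem onFst_mul_injective {W : Type*} [AddCommGroup W] [Module ℂ W] {z z' : V ⊗[ℂ] W}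
    (h : ∀ d, onFst (H.m d) z = onFst (H.m d) z') : z = z' :=
  onFst_injective (fun d => H.m d) (fun w hw => H.nondeg_right w hw) h

/-- In Sweedler notation `iteratedMap` sends $x\otimes y$ to $p_1\otimes p_2x\otimes p_3y$. Covering
the first leg by $d$ allows $p_2\otimes p_3$ to be read as $\Delta$ of one leg acting on $z$. -/
theorem onFst_iteratedMap (d p : V) (z : V ⊗[ℂ] V) :
    onFst (H.m d) (H.iteratedMap p z) = onSnd (H.dlAt z) (H.T₂ (d ⊗ₜ p)) := by
  induction z with
  | zero =>
    have : H.dlAt 0 = 0 := by ext a; simp [dlAt]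
    rw [this]
    simp [TensorProduct.map_zero_right]
  | add x y hx hy =>
    simp only [map_add, hx, hy, dlAt_add, TensorProduct.map_add_right, LinearMap.add_apply]
  | tmul x y =>
    have h₁ : onFst (H.m d) ∘ₗ fixSnd H.T₁.toLinearMap x =
        onSnd (H.m.flip x) ∘ₗ fixFst H.T₂.toLinearMap d := by
      ext r
      simpa using H.T₁_T₂ d r x
    have h₂ : onFst (H.m.flip x) ∘ₗ fixSnd H.T₁.toLinearMap y = H.dlAt (x ⊗ₜ y) := by
      ext r
      simp [dlAt, H.dl_eq_T₁]
    rw [iteratedMap_tmul, onFst_assoc, onFst_onFst, h₁, ← onFst_onFst, ← onSnd_onFst_assoc,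
      H.coassoc, onSnd_onSnd, h₂]

/-- Coassociativity in the form `(Δ ⊗ ι)(Δ(p))(1 ⊗ Δ(q)(b ⊗ 1)) = (ι ⊗ Δ)(Δ(p)(1 ⊗ q))(1 ⊗ b ⊗ 1)`. -/
theorem iteratedMap_T₃ (p q b : V) : H.iteratedMap p (H.T₃ (q ⊗ₜ b)) =
    onSnd (fixSnd H.T₃.toLinearMap b) (H.T₁ (p ⊗ₜ q)) := by
  refine H.onFst_mul_injective fun d => ?_
  rw [onFst_iteratedMap, dlAt_T₃, ← onSnd_onSnd, ← H.T₁_T₂, onFst_onSnd]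

/-- `φ` is a left integral. -/
def IsIntegral (φ : Module.Dual ℂ V) : Prop :=
  φ ≠ 0 ∧ (∀ a b, sliceRight φ (H.T₃ (a ⊗ₜ b)) = φ a • b) ∧
    ∀ a b, sliceRight φ (H.T₂ (b ⊗ₜ a)) = φ a • b

variable {H} {φ : Module.Dual ℂ V} {ε : Module.Dual ℂ V}

theorem IsIntegral.op (hφ : H.IsIntegral φ) : H.op.IsIntegral φ :=
  ⟨hφ.1, fun a b => hφ.2.2 a b, fun a b => hφ.2.1 a b⟩

theorem onSnd_sliceRight_assoc (φ : Module.Dual ℂ V) (f : V →ₗ[ℂ] V ⊗[ℂ] V) (w : V ⊗[ℂ] V) :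
    onSnd (sliceRight φ) (TensorProduct.assoc ℂ V V V (onFst f w)) = f (sliceRight φ w) := by
  induction w with
  | zero => simp
  | add x y hx hy => simp only [map_add, hx, hy]
  | tmul r s =>
    simp only [TensorProduct.map_tmul, LinearMap.id_apply, sliceRight_tmul, map_smul]
    generalize f r = t
    induction t with
    | zero => simp
    | add x y hx hy => simp only [map_add, TensorProduct.add_tmul, hx, hy, smul_add]
    | tmul a b => simp

/-- The map $(\varepsilon\otimes\iota)T_1^{-1}$ is the future $a\otimes b\mapsto S(a)b$, so this is
strong left invariance before $S$ is known. It is also what produces $S$, because every element is a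
slice $(\iota\otimes\varphi)(T_1z)$. -/
theorem IsIntegral.sliceLeft_T₁_symm (hφ : H.IsIntegral φ) (hε : H.IsCounit ε) (z : V ⊗[ℂ] V)
    (b : V) : sliceLeft ε (H.T₁.symm (sliceRight φ (H.T₁ z) ⊗ₜ b)) =
      H.m (sliceRight φ (H.T₄ z)) b := by
  have h : sliceLeft ε ∘ₗ H.T₁.symm.toLinearMap ∘ₗ (TensorProduct.mk ℂ V V).flip b ∘ₗ
      sliceRight φ ∘ₗ H.T₁.toLinearMap = H.m.flip b ∘ₗ sliceRight φ ∘ₗ H.T₄.toLinearMap := by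
    refine TensorProduct.ext' fun p q => ?_
    -- Two evaluations of `κ` are compared: on $x\otimes y$ the map $T_1$ cancels, while on
    -- $\Delta(q)(b\otimes1)$ the factors $p_2q$ combine and left invariance applies.
    let κ : V ⊗[ℂ] V →ₗ[ℂ] V ⊗[ℂ] V := H.T₁.symm.toLinearMap ∘ₗ onSnd (sliceRight φ) ∘ₗ
      H.iteratedMap p
    have hκ (x y : V) : κ (x ⊗ₜ y) = sliceRight φ (H.T₁ (p ⊗ₜ y)) ⊗ₜ x := by
      simp only [κ, LinearMap.comp_apply, iteratedMap_tmul, onSnd_sliceRight_assoc]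
      simp
    have hκ' : κ (H.T₃ (q ⊗ₜ b)) = H.T₁.symm (sliceRight φ (H.T₁ (p ⊗ₜ q)) ⊗ₜ b) := by
      have e : sliceRight φ ∘ₗ fixSnd H.T₃.toLinearMap b = LinearMap.toSpanSingleton ℂ V b ∘ₗ φ := by
        ext r
        simp [hφ.2.1]
      simp only [κ, LinearMap.comp_apply, iteratedMap_T₃, onSnd_onSnd, e, LinearEquiv.coe_coe]
      congr 1
      generalize H.T₁ (p ⊗ₜ q) = w
      induction w with
      | zero => simp
      | add x y hx hy => simp only [map_add, TensorProduct.add_tmul, hx, hy]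
      | tmul x y => simp [TensorProduct.smul_tmul]
    have e₂ : sliceLeft ε ∘ₗ κ = sliceRight (φ ∘ₗ H.m p) := by
      refine TensorProduct.ext' fun x y => ?_
      simp [hκ, ← apply_sliceLeft, hε.1]
    have := LinearMap.congr_fun e₂ (H.T₃ (q ⊗ₜ b))
    simp only [LinearMap.comp_apply, hκ', ← sliceRight_onSnd] at this
    rw [H.T₃_T₄, sliceRight_onFst] at this
    simpa using this
  exact LinearMap.congr_fun h z

variable (H) in
/-- `S` is an antipode: `m(S ⊗ ι)(Δ(a)(1 ⊗ b)) = ε(a)b`. -/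
def IsAntipode (ε : Module.Dual ℂ V) (S : V →ₗ[ℂ] V) : Prop :=
  ∀ a b, TensorProduct.lift H.m (onFst S (H.T₁ (a ⊗ₜ b))) = ε a • b

variable {S : V →ₗ[ℂ] V}

theorem IsAntipode.sliceLeft_T₁_symm (hS : H.IsAntipode ε S) (a b : V) :
    sliceLeft ε (H.T₁.symm (a ⊗ₜ b)) = H.m (S a) b := by
  have := linearMap_ext_of_equiv H.T₁ (f := sliceLeft ε ∘ₗ H.T₁.symm.toLinearMap)
    (g := TensorProduct.lift H.m ∘ₗ onFst S) (fun p q => by simp [hS p q]) (a ⊗ₜ b)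
  simpa using this

theorem isAntipode_of_sliceLeft (h : ∀ a b, sliceLeft ε (H.T₁.symm (a ⊗ₜ b)) = H.m (S a) b) :
    H.IsAntipode ε S := by
  have e : TensorProduct.lift H.m ∘ₗ onFst S = sliceLeft ε ∘ₗ H.T₁.symm.toLinearMap :=
    TensorProduct.ext' fun a b => by simp [h]
  intro a b
  simpa using LinearMap.congr_fun e (H.T₁ (a ⊗ₜ b))

theorem IsAntipode.unique (hS : H.IsAntipode ε S) {S' : V →ₗ[ℂ] V} (hS' : H.IsAntipode ε S') :
    S' = S := by
  ext a
  rw [← sub_eq_zero]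
  refine H.nondeg_left _ fun b => ?_
  rw [map_sub, LinearMap.sub_apply, ← hS.sliceLeft_T₁_symm, ← hS'.sliceLeft_T₁_symm, sub_self]

/-- Strong left invariance, the main computational tool for everything that follows. -/
theorem IsIntegral.antipode_sliceRight (hφ : H.IsIntegral φ) (hε : H.IsCounit ε)
    (hS : H.IsAntipode ε S) (z : V ⊗[ℂ] V) :
    S (sliceRight φ (H.T₁ z)) = sliceRight φ (H.T₄ z) := by
  rw [← sub_eq_zero]
  refine H.nondeg_left _ fun b => ?_
  rw [map_sub, LinearMap.sub_apply, ← hS.sliceLeft_T₁_symm, hφ.sliceLeft_T₁_symm hε, sub_self]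

theorem IsIntegral.exists_isAntipode (hφ : H.IsIntegral φ) (hε : H.IsCounit ε) :
    ∃ S, H.IsAntipode ε S := by
  have h (a : V) : ∃ s, ∀ b, sliceLeft ε (H.T₁.symm (a ⊗ₜ b)) = H.m s b := by
    obtain ⟨w, rfl⟩ := sliceRight_surjective hφ.1 a
    obtain ⟨z, rfl⟩ := H.T₁.surjective w
    exact ⟨_, hφ.sliceLeft_T₁_symm hε z⟩
  choose s hs using h
  have uniq {x y : V} (h : ∀ b, H.m x b = H.m y b) : x = y :=
    sub_eq_zero.1 (H.nondeg_left _ fun b => by rw [map_sub, LinearMap.sub_apply, h, sub_self])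
  refine ⟨⟨⟨s, fun a a' => uniq fun b => ?_⟩, fun r a => uniq fun b => ?_⟩,
    isAntipode_of_sliceLeft hs⟩
  · rw [← hs, map_add, LinearMap.add_apply, ← hs, ← hs, TensorProduct.add_tmul, map_add, map_add]
  · rw [← hs, RingHom.id_apply, map_smul, LinearMap.smul_apply, ← hs,
      ← TensorProduct.smul_tmul', map_smul, map_smul]

/-- The antipodes of `A` and of the opposite algebra are inverse to each other. -/
theorem IsIntegral.exists_antipode_equiv [Nontrivial V] (hφ : H.IsIntegral φ)
    (hε : H.IsCounit ε) : ∃ S : V ≃ₗ[ℂ] V, H.IsAntipode ε S.toLinearMap ∧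
      H.op.IsAntipode ε S.symm.toLinearMap := by
  obtain ⟨S, hS⟩ := hφ.exists_isAntipode hε
  obtain ⟨S', hS'⟩ := hφ.op.exists_isAntipode hε.op
  have h (z : V ⊗[ℂ] V) : S' (sliceRight φ (H.T₄ z)) = sliceRight φ (H.T₁ z) := by
    simpa [HopfData.op] using hφ.op.antipode_sliceRight hε.op hS' (TensorProduct.comm ℂ V V z)
  refine ⟨LinearEquiv.ofLinearMap S S' ?_ ?_, hS, hS'⟩
  · ext a
    obtain ⟨w, rfl⟩ := sliceRight_surjective hφ.1 a
    obtain ⟨z, rfl⟩ := H.T₄.surjective w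
    simp [h, hφ.antipode_sliceRight hε hS]
  · ext a
    obtain ⟨w, rfl⟩ := sliceRight_surjective hφ.1 a
    obtain ⟨z, rfl⟩ := H.T₁.surjective w
    simp [h, hφ.antipode_sliceRight hε hS]

theorem onSnd_sliceLeft_coverLeft (hε : H.IsCounit ε) (a : V) (w : V ⊗[ℂ] V) :
    onSnd (sliceLeft ε) (H.coverLeft a w) = onFst (H.m a) w := by
  have h : onSnd (sliceLeft ε) ∘ₗ H.coverLeft a = onFst (H.m a) := by
    refine TensorProduct.ext' fun b c => ?_
    simp only [LinearMap.comp_apply, onSnd_coverLeft_tmul, TensorProduct.map_tmul,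
      LinearMap.id_apply]
    rw [← hε.2]
    generalize H.T₂ (a ⊗ₜ b) = t
    induction t with
    | zero => simp
    | add x y hx hy => simp only [map_add, TensorProduct.add_tmul, hx, hy]
    | tmul x y => simp [TensorProduct.smul_tmul]
  exact LinearMap.congr_fun h w

/-- The second law of the antipode: `m(ι ⊗ S)((a ⊗ 1)Δ(b)) = ε(b)a`. -/
theorem IsAntipode.lift_onSnd_T₂ (hS : H.IsAntipode ε S) (hε : H.IsCounit ε) (a b : V) :
    TensorProduct.lift H.m (onSnd S (H.T₂ (a ⊗ₜ b))) = ε b • a := by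
  rw [← sub_eq_zero]
  refine H.nondeg_left _ fun c => ?_
  rw [map_sub, LinearMap.sub_apply, sub_eq_zero]
  -- Multiplying the two legs of this identity gives $m(\iota\otimes S)((a\otimes1)\Delta(b))\,c$ on
  -- the left. On the right it gives $a\,m(T_1^{-1}(b\otimes c))=\varepsilon(b)ac$.
  have h₁ : onSnd (sliceLeft ε ∘ₗ H.T₁.symm.toLinearMap) (H.coverLeft a (b ⊗ₜ c)) =
      onFst (H.m a) (H.T₁.symm (b ⊗ₜ c)) := by
    rw [← onSnd_onSnd, onSnd_T₁_symm_coverLeft, onSnd_sliceLeft_coverLeft hε]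
  rw [onSnd_coverLeft_tmul] at h₁
  have h₂ : fixSnd (sliceLeft ε ∘ₗ H.T₁.symm.toLinearMap) c = H.m.flip c ∘ₗ S := by
    ext x
    simp [hS.sliceLeft_T₁_symm]
  rw [h₂] at h₁
  have h₃ := congrArg (TensorProduct.lift H.m) h₁
  have e₁ : ∀ z : V ⊗[ℂ] V, TensorProduct.lift H.m (onSnd (H.m.flip c ∘ₗ S) z) =
      H.m (TensorProduct.lift H.m (onSnd S z)) c := by
    intro z
    induction z with
    | zero => simp
    | add x y hx hy => simp only [map_add, hx, hy, LinearMap.add_apply]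
    | tmul x y => simp [H.assoc]
  have e₂ : ∀ z : V ⊗[ℂ] V, TensorProduct.lift H.m (onFst (H.m a) z) =
      H.m a (TensorProduct.lift H.m z) := by
    intro z
    induction z with
    | zero => simp
    | add x y hx hy => simp only [map_add, hx, hy]
    | tmul x y => simp [H.assoc]
  have e₃ : TensorProduct.lift H.m (H.T₁.symm (b ⊗ₜ c)) = ε b • c := by
    have := linearMap_ext_of_equiv H.T₁ (f := TensorProduct.lift H.m ∘ₗ H.T₁.symm.toLinearMap)
      (g := sliceLeft ε) (fun p q => by simp [hε.1]) (b ⊗ₜ c)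
    simpa using this
  rw [e₁, e₂, e₃] at h₃
  simpa using h₃

theorem IsAntipode.opCoop (hS : H.IsAntipode ε S) (hε : H.IsCounit ε) :
    H.opCoop.IsAntipode ε S := by
  intro a b
  rw [← hS.lift_onSnd_T₂ hε b a]
  simp only [HopfData.opCoop, LinearEquiv.trans_apply, TensorProduct.comm_tmul]
  generalize H.T₂ (b ⊗ₜ a) = z
  induction z with
  | zero => simp
  | add x y hx hy => simp only [map_add, hx, hy]
  | tmul x y => simp

/-- Since $T_1^{-1}$ turns the action of $\Delta(p)$ into left multiplication by $p$, the map
$m(S\otimes\iota)$ sends $\Delta(p)z$ to $\varepsilon(p)\,m(S\otimes\iota)(z)$. Taking $z=b\otimes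
q$ shows that right multiplication by $b$ inside $S$ comes out as $S(b)$ on the left. -/
theorem IsAntipode.map_mul (hS : H.IsAntipode ε S) [Nontrivial V] (hε : H.IsCounit ε) (a b : V) :
    S (H.m a b) = H.m (S b) (S a) := by
  rw [← sub_eq_zero]
  refine H.nondeg_left _ fun c => ?_
  rw [map_sub, LinearMap.sub_apply, sub_eq_zero, H.assoc, ← hS.sliceLeft_T₁_symm,
    ← hS.sliceLeft_T₁_symm a]
  -- `Δ(p)(b ⊗ q)` is computed with `b ⊗ q` in the range of `T₁`
  have h₁ (p : V) (z : V ⊗[ℂ] V) : sliceLeft ε (H.T₁.symm (H.dl p z)) =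
      ε p • sliceLeft ε (H.T₁.symm z) :=
    linearMap_ext_of_equiv H.T₁ (f := sliceLeft ε ∘ₗ H.T₁.symm.toLinearMap ∘ₗ H.dl p)
      (g := ε p • (sliceLeft ε ∘ₗ H.T₁.symm.toLinearMap))
      (fun r s => by simp [H.dl_T₁, hε.map_mul, smul_smul]) z
  have h₂ := linearMap_ext_of_equiv H.T₁
    (f := sliceLeft ε ∘ₗ H.T₁.symm.toLinearMap ∘ₗ onFst (H.m.flip b))
    (g := H.m (S b) ∘ₗ sliceLeft ε ∘ₗ H.T₁.symm.toLinearMap)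
    (fun p q => by
      simp only [LinearMap.comp_apply, ← H.dl_eq_T₁, LinearEquiv.coe_coe, h₁]
      simp [hS.sliceLeft_T₁_symm]) (a ⊗ₜ c)
  simpa using h₂

end HopfData

/-! ### Anti-comultiplicativity of the antipode and faithfulness of the integral. -/

namespace HopfData

variable {V : Type*} [AddCommGroup V] [Module ℂ V] {H : HopfData V} {ε : Module.Dual ℂ V}
  {S : V →ₗ[ℂ] V} {φ : Module.Dual ℂ V}

theorem IsAntipode.lift_onFst_T₃ [Nontrivial V] (hS : H.IsAntipode ε S) (hε : H.IsCounit ε)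
    (q d : V) : TensorProduct.lift H.m (onFst S (H.T₃ (q ⊗ₜ d))) = ε q • S d := by
  rw [← sub_eq_zero]
  refine H.nondeg_left _ fun y => ?_
  have e₁ : ∀ z : V ⊗[ℂ] V, H.m (TensorProduct.lift H.m (onFst S z)) y =
      TensorProduct.lift H.m (onFst S (onSnd (H.m.flip y) z)) := by
    intro z
    induction z with
    | zero => simp
    | add x y hx hy => simp only [map_add, hx, hy, LinearMap.add_apply]
    | tmul x y => simp [H.assoc]
  have e₂ : ∀ z : V ⊗[ℂ] V, TensorProduct.lift H.m (onFst S (onFst (H.m.flip d) z)) =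
      H.m (S d) (TensorProduct.lift H.m (onFst S z)) := by
    intro z
    induction z with
    | zero => simp
    | add x y hx hy => simp only [map_add, hx, hy]
    | tmul x y => simp [H.assoc, hS.map_mul hε]
  rw [map_sub, LinearMap.sub_apply, sub_eq_zero, e₁, ← H.dl_eq_T₃, H.dl_eq_T₁, e₂, hS]
  simp

/-- `(ι ⊗ m(S ⊗ ι))((Δ ⊗ ι)(Δ(a))(1 ⊗ b ⊗ x)) = a ⊗ S(b)x`. -/
theorem IsAntipode.onSnd_iteratedMap [Nontrivial V] (hS : H.IsAntipode ε S) (hε : H.IsCounit ε)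
    (a : V) (z : V ⊗[ℂ] V) :
    onSnd (TensorProduct.lift H.m ∘ₗ onFst S) (H.iteratedMap a z) =
      a ⊗ₜ TensorProduct.lift H.m (onFst S z) := by
  refine linearMap_ext_of_equiv H.T₃
    (f := onSnd (TensorProduct.lift H.m ∘ₗ onFst S) ∘ₗ H.iteratedMap a)
    (g := TensorProduct.mk ℂ V V a ∘ₗ TensorProduct.lift H.m ∘ₗ onFst S) (fun q d => ?_) z
  have e : (TensorProduct.lift H.m ∘ₗ onFst S) ∘ₗ fixSnd H.T₃.toLinearMap d =
      LinearMap.toSpanSingleton ℂ V (S d) ∘ₗ ε := by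
    ext r
    simp [hS.lift_onFst_T₃ hε]
  simp only [LinearMap.comp_apply, iteratedMap_T₃, TensorProduct.mk_apply,
    hS.lift_onFst_T₃ hε, onSnd_onSnd, e]
  rw [← TensorProduct.smul_tmul, ← hε.sliceRight_T₁]
  generalize H.T₁ (a ⊗ₜ q) = w
  induction w with
  | zero => simp
  | add x y hx hy => simp only [map_add, TensorProduct.add_tmul, hx, hy]
  | tmul x y => simp [TensorProduct.smul_tmul]

theorem onFst_mul_dl (a b x y : V) : onFst (H.m a) (H.dl b (x ⊗ₜ y)) =
    TensorProduct.map (H.m.flip x) (H.m.flip y) (H.T₂ (a ⊗ₜ b)) := by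
  have h : H.m a ∘ₗ H.m.flip x = H.m.flip x ∘ₗ H.m a := by
    ext c
    simp [H.assoc]
  rw [H.dl_eq_T₁, onFst_onFst, h, ← onFst_onFst, H.T₁_T₂, TensorProduct.map_map]
  rfl

theorem map_mulRight_injective {z z' : V ⊗[ℂ] V}
    (h : ∀ x y, TensorProduct.map (H.m.flip x) (H.m.flip y) z =
      TensorProduct.map (H.m.flip x) (H.m.flip y) z') : z = z' := by
  refine onFst_injective (fun x => H.m.flip x) (fun w hw => H.nondeg_left w hw) fun x => ?_
  refine onSnd_injective (fun y => H.m.flip y) (fun w hw => H.nondeg_left w hw) fun y => ?_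
  simpa [TensorProduct.map_map] using h x y

variable (H) in
/-- The map `(u ⊗ v) ⊗ (x ⊗ y) ↦ S(v)x ⊗ S(u)y`. -/
def twistedAction (S : V →ₗ[ℂ] V) : (V ⊗[ℂ] V) ⊗[ℂ] (V ⊗[ℂ] V) →ₗ[ℂ] V ⊗[ℂ] V :=
  TensorProduct.map (TensorProduct.lift H.m) (TensorProduct.lift H.m) ∘ₗ
    (TensorProduct.tensorTensorTensorComm ℂ V V V V).toLinearMap ∘ₗ
      onFst (TensorProduct.map S S ∘ₗ flipMap V)

theorem twistedAction_tmul (S : V →ₗ[ℂ] V) (z : V ⊗[ℂ] V) (x y : V) :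
    H.twistedAction S (z ⊗ₜ (x ⊗ₜ y)) =
      TensorProduct.map (H.m.flip x) (H.m.flip y) (TensorProduct.map S S (flipMap V z)) := by
  induction z with
  | zero => simp
  | add x y hx hy => simp only [map_add, TensorProduct.add_tmul, hx, hy]
  | tmul u v => simp [twistedAction]

theorem IsAntipode.twistedAction_assoc [Nontrivial V] (hS : H.IsAntipode ε S)
    (hε : H.IsCounit ε) (b r s x : V) :
    H.twistedAction S (onFst (fixSnd H.T₁.toLinearMap b)
      (TensorProduct.assoc ℂ V V V (H.T₁ (r ⊗ₜ x) ⊗ₜ s))) = H.m (S b) x ⊗ₜ H.m (S r) s := by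
  have h : ∀ t : V ⊗[ℂ] V, H.twistedAction S (onFst (fixSnd H.T₁.toLinearMap b)
      (TensorProduct.assoc ℂ V V V (t ⊗ₜ s))) = flipMap V (onFst (H.m.flip s ∘ₗ S)
        (onSnd (TensorProduct.lift H.m ∘ₗ onFst S)
          (TensorProduct.assoc ℂ V V V (onFst (fixSnd H.T₁.toLinearMap b) t)))) := by
    intro t
    induction t with
    | zero => simp
    | add x y hx hy => simp only [map_add, TensorProduct.add_tmul, hx, hy]
    | tmul r x =>
      simp only [TensorProduct.assoc_tmul, TensorProduct.map_tmul, LinearMap.id_apply]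
      generalize fixSnd H.T₁.toLinearMap b r = g
      rw [twistedAction_tmul]
      induction g with
      | zero => simp
      | add x y hx hy => simp only [map_add, TensorProduct.add_tmul, hx, hy]
      | tmul u v => simp
  rw [h, ← iteratedMap_tmul, hS.onSnd_iteratedMap hε]
  simp

/-- In Sweedler notation $S(a_2b)a_3x\otimes S(a_1)a_4y$ collapses to $\varepsilon(a)\,S(b)x\otimes
y$: the inner pair cancels first, then the outer one. -/
theorem IsAntipode.twistedAction_iteratedMap [Nontrivial V] (hS : H.IsAntipode ε S)
    (hε : H.IsCounit ε) (a b : V) (z : V ⊗[ℂ] V) :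
    H.twistedAction S (onFst (fixSnd H.T₁.toLinearMap b) (H.iteratedMap a z)) =
      ε a • onFst (H.m (S b)) z := by
  induction z with
  | zero => simp
  | add x y hx hy => simp only [map_add, hx, hy, smul_add]
  | tmul x y =>
    have h : ∀ w : V ⊗[ℂ] V, H.twistedAction S (onFst (fixSnd H.T₁.toLinearMap b)
        (TensorProduct.assoc ℂ V V V (onFst (fixSnd H.T₁.toLinearMap x) w))) =
          H.m (S b) x ⊗ₜ TensorProduct.lift H.m (onFst S w) := by
      intro w
      induction w with
      | zero => simp
      | add x y hx hy => simp only [map_add, TensorProduct.tmul_add, hx, hy]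
      | tmul r s => simpa using hS.twistedAction_assoc hε b r s x
    rw [iteratedMap_tmul, h, hS]
    simp

/-- The antipode is anti-comultiplicative: `(S ⊗ S)(Δ(a)(1 ⊗ b))` is the flip of
`(S(b) ⊗ 1)Δ(S(a))`. -/
theorem IsAntipode.map_T₁ [Nontrivial V] (hS : H.IsAntipode ε S) (hε : H.IsCounit ε) (a b : V) :
    TensorProduct.map S S (H.T₁ (a ⊗ₜ b)) = flipMap V (H.T₂ (S b ⊗ₜ S a)) := by
  -- `U` lets $(S(b)\otimes1)\Delta(S(p))$ act on $w$, and `W` lets the flip of $(S\otimes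
  -- S)(\Delta(p)(1\otimes b))$ act on $w$. It suffices that these actions agree.
  let U : V ⊗[ℂ] (V ⊗[ℂ] V) →ₗ[ℂ] V ⊗[ℂ] V := TensorProduct.lift
    (LinearMap.mk₂ ℂ (fun p w => onFst (H.m (S b)) (H.dl (S p) w))
      (fun p p' w => by simp only [map_add, dl_add])
      (fun r p w => by simp only [map_smul, dl_smul])
      (fun p w w' => by simp only [map_add])
      (fun r p w => by simp only [map_smul]))
  have hU (p : V) (w : V ⊗[ℂ] V) : U (p ⊗ₜ w) = onFst (H.m (S b)) (H.dl (S p) w) := by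
    simp only [U, TensorProduct.lift.tmul]
    rfl
  let W : V ⊗[ℂ] (V ⊗[ℂ] V) →ₗ[ℂ] V ⊗[ℂ] V :=
    H.twistedAction S ∘ₗ onFst (fixSnd H.T₁.toLinearMap b)
  -- With $t=\Delta(a)(1\otimes q)$ both sides equal
  -- $\varepsilon(a)(S(b)\otimes1)\Delta(q)(d\otimes1)$: on the `U` side because
  -- $\Delta(S(a_1))\Delta(a_2q)=\varepsilon(a)\Delta(q)$, on the `W` side by
  -- `twistedAction_iteratedMap`.
  have hUW (d : V) (t : V ⊗[ℂ] V) : U (onSnd (fixSnd H.T₃.toLinearMap d) t) =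
      W (onSnd (fixSnd H.T₃.toLinearMap d) t) := by
    refine linearMap_ext_of_equiv H.T₁ (f := U ∘ₗ onSnd (fixSnd H.T₃.toLinearMap d))
      (g := W ∘ₗ onSnd (fixSnd H.T₃.toLinearMap d)) (fun a q => ?_) t
    have e : ∀ t : V ⊗[ℂ] V, U (onSnd (fixSnd H.T₃.toLinearMap d) t) =
        onFst (H.m (S b)) (H.T₃ (TensorProduct.lift H.m (onFst S t) ⊗ₜ d)) := by
      intro t
      induction t with
      | zero => simp
      | add x y hx hy => simp only [map_add, TensorProduct.add_tmul, hx, hy]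
      | tmul p r => simp [hU, H.dl_T₃]
    rw [LinearMap.comp_apply, LinearMap.comp_apply, e, hS, ← iteratedMap_T₃]
    simp only [W, LinearMap.comp_apply, hS.twistedAction_iteratedMap hε]
    rw [← TensorProduct.smul_tmul', map_smul, map_smul]
  have hUW' (p : V) (w : V ⊗[ℂ] V) : U (p ⊗ₜ w) = W (p ⊗ₜ w) := by
    refine linearMap_ext_of_equiv H.T₃ (f := U ∘ₗ TensorProduct.mk ℂ V (V ⊗[ℂ] V) p)
      (g := W ∘ₗ TensorProduct.mk ℂ V (V ⊗[ℂ] V) p) (fun q d => ?_) w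
    simpa using hUW d (p ⊗ₜ q)
  apply (TensorProduct.comm ℂ V V).injective
  refine map_mulRight_injective (H := H) fun x y => ?_
  have := hUW' a (x ⊗ₜ y)
  rw [hU, onFst_mul_dl] at this
  simp only [W, LinearMap.comp_apply, TensorProduct.map_tmul, LinearMap.id_apply] at this
  rw [twistedAction_tmul] at this
  simpa [TensorProduct.map_comm] using this.symm

theorem sliceRight_zero : sliceRight (0 : Module.Dual ℂ V) = 0 :=
  TensorProduct.ext' fun a b => by simp

/-- Faithfulness of the left integral. -/
theorem IsIntegral.faithful [Nontrivial V] (hφ : H.IsIntegral φ) {a : V}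
    (ha : ∀ x, φ (H.m x a) = 0) : a = 0 := by
  obtain ⟨ε, hε⟩ := H.exists_isCounit
  obtain ⟨S, hS, -⟩ := hφ.exists_antipode_equiv hε
  -- By strong invariance this slice is $S$ of $(\iota\otimes\varphi)(\Delta(x)(1\otimes n))$, which
  -- vanishes after left multiplication by any $d$.
  have h₁ {n : V} (hn : ∀ x, φ (H.m x n) = 0) (x : V) : sliceRight φ (H.T₄ (x ⊗ₜ n)) = 0 := by
    rw [← hφ.antipode_sliceRight hε hS]
    have : sliceRight φ (H.T₁ (x ⊗ₜ n)) = 0 := by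
      refine H.nondeg_right _ fun d => ?_
      have e : φ ∘ₗ H.m.flip n = 0 := by
        ext y
        simp [hn]
      rw [← sliceRight_onFst, H.T₁_T₂, sliceRight_onSnd, e, sliceRight_zero]
      rfl
    rw [this, map_zero]
  -- The value $\varphi(m(S\otimes\iota)(\Delta(n)(x'\otimes1)))=\varepsilon(n)\varphi(S(x'))$
  -- depends on the second leg only through the functionals $\varphi(\,\cdot\,q)$, and `h₁` kills
  -- these. Taking $x'=S^{-1}(y)$ with $\varphi(y)=1$ isolates $\varepsilon(n)$.
  have h₂ {n : V} (hn : ∀ x, φ (H.m x n) = 0) : ε n = 0 := by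
    obtain ⟨y, hy⟩ := exists_apply_eq_one hφ.1
    let F : V →ₗ[ℂ] Module.Dual ℂ V := LinearMap.mk₂ ℂ (fun q x => φ (H.m x q))
      (by simp) (by simp) (by simp) (by simp)
    let x' := S.symm y
    have hz : onSnd F (H.T₃ (n ⊗ₜ x')) = 0 := by
      refine onSnd_injective (fun x : V => (LinearMap.applyₗ x : Module.Dual ℂ V →ₗ[ℂ] ℂ))
        (fun w hw => LinearMap.ext hw) fun x => ?_
      rw [map_zero, onSnd_onSnd]
      apply (TensorProduct.rid ℂ V).injective
      have := congrArg (sliceRight φ) (H.T₃_T₄ x n x')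
      rw [sliceRight_onFst, h₁ hn, map_zero, sliceRight_onSnd] at this
      rw [map_zero, ← this]
      rfl
    have e : ∀ z : V ⊗[ℂ] V, φ (TensorProduct.lift H.m (onFst S.toLinearMap z)) =
        TensorProduct.lift (LinearMap.applyₗ ∘ₗ S.toLinearMap) (onSnd F z) := by
      intro z
      induction z with
      | zero => simp
      | add x y hx hy => simp only [map_add, hx, hy]
      | tmul p q => simp [F]
    have := e (H.T₃ (n ⊗ₜ x'))
    rw [hz, hS.lift_onFst_T₃ hε] at this
    simpa [x', hy] using this
  refine H.nondeg_right _ fun d => ?_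
  refine (Module.forall_dual_apply_eq_zero_iff ℂ _).1 fun ω => ?_
  -- The slice $(\omega\otimes\iota)((d\otimes1)\Delta(a))$ inherits the hypothesis on $a$ by `h₁`,
  -- so `h₂` applies to it, and its counit is $\omega(da)$.
  rw [← hε.2, ← apply_sliceLeft]
  refine h₂ fun x => ?_
  rw [← sliceLeft_onSnd, apply_sliceLeft, ← H.dr_eq_T₂, H.dr_eq_T₄, sliceRight_onFst, h₁ ha,
    map_zero, map_zero]

/-! ### The right integral and the comparison of the translates of both integrals. -/

section Equiv

variable [Nontrivial V] {S : V ≃ₗ[ℂ] V}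

theorem IsAntipode.map_T₃ (hS : H.IsAntipode ε S.toLinearMap) (hε : H.IsCounit ε) (a b : V) :
    TensorProduct.map S.toLinearMap S.toLinearMap (H.T₃ (a ⊗ₜ b)) =
      flipMap V (H.T₄ (S b ⊗ₜ S a)) := by
  refine onSnd_injective (fun c => H.m (S c)) (fun w hw => H.nondeg_right w fun a => ?_)
    fun c => ?_
  · simpa using hw (S.symm a)
  have e₁ : H.m (S c) ∘ₗ S.toLinearMap = S.toLinearMap ∘ₗ H.m.flip c := by
    ext x
    simpa using (hS.map_mul hε x c).symm
  have e₂ : S.toLinearMap ∘ₗ H.m.flip b = H.m (S b) ∘ₗ S.toLinearMap := by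
    ext x
    simpa using hS.map_mul hε x b
  have h₁ : onSnd (H.m (S c)) (TensorProduct.map S.toLinearMap S.toLinearMap (H.T₃ (a ⊗ₜ b))) =
      TensorProduct.map S.toLinearMap S.toLinearMap (onSnd (H.m.flip c) (H.T₃ (a ⊗ₜ b))) := by
    simp [TensorProduct.map_map, e₁]
  have h₂ : TensorProduct.map S.toLinearMap S.toLinearMap (onFst (H.m.flip b) (H.T₁ (a ⊗ₜ c))) =
      onFst (H.m (S b)) (TensorProduct.map S.toLinearMap S.toLinearMap (H.T₁ (a ⊗ₜ c))) := by
    simp [TensorProduct.map_map, e₂]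
  rw [h₁, ← H.dl_eq_T₃, H.dl_eq_T₁, h₂, hS.map_T₁ hε]
  have h₃ := H.dr_eq_T₂ (S a) (S c) (S b)
  rw [H.dr_eq_T₄] at h₃
  simpa [TensorProduct.map_comm] using congrArg (flipMap V) h₃.symm

/-- Right invariance of $\psi=\varphi\circ S$: since $S$ reverses the legs of $\Delta$, applying $S$
to the slice turns it into a left-invariance identity for $\varphi$. -/
theorem IsIntegral.opCoop (hφ : H.IsIntegral φ) (hε : H.IsCounit ε)
    (hS : H.IsAntipode ε S.toLinearMap) : H.opCoop.IsIntegral (φ ∘ₗ S.toLinearMap) := by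
  have h (a b : V) : sliceLeft (φ ∘ₗ S.toLinearMap) (H.T₁ (a ⊗ₜ b)) = φ (S a) • b := by
    apply S.injective
    have := sliceLeft_map φ S.toLinearMap S.toLinearMap (H.T₁ (a ⊗ₜ b))
    rw [hS.map_T₁ hε, LinearEquiv.coe_coe, sliceLeft_comm, LinearEquiv.coe_coe, hφ.2.2] at this
    simpa using this.symm
  refine ⟨fun h0 => hφ.1 ?_, fun a b => ?_, fun a b => ?_⟩
  · ext x
    simpa using LinearMap.congr_fun h0 (S.symm x)
  · simp only [HopfData.opCoop, LinearEquiv.trans_apply, TensorProduct.comm_tmul, sliceRight_comm]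
    rw [← sub_eq_zero]
    refine H.nondeg_left _ fun y => ?_
    rw [map_sub, LinearMap.sub_apply, sub_eq_zero, ← LinearMap.flip_apply, ← sliceLeft_onSnd,
      ← H.T₁_T₄, sliceLeft_onSnd, h]
    simp
  · simpa [HopfData.opCoop, sliceRight_comm] using h a b

theorem IsIntegral.sliceLeft_T₄ (hφ : H.IsIntegral φ) (hε : H.IsCounit ε)
    (hS : H.IsAntipode ε S.toLinearMap) (a b : V) :
    sliceLeft (φ ∘ₗ S.toLinearMap) (H.T₄ (a ⊗ₜ b)) = φ (S b) • a := by
  simpa [HopfData.opCoop, sliceRight_comm] using (hφ.opCoop hε hS).2.1 b a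

theorem IsIntegral.sliceLeft_T₁ (hφ : H.IsIntegral φ) (hε : H.IsCounit ε)
    (hS : H.IsAntipode ε S.toLinearMap) (a b : V) :
    sliceLeft (φ ∘ₗ S.toLinearMap) (H.T₁ (a ⊗ₜ b)) = φ (S a) • b := by
  simpa [HopfData.opCoop, sliceRight_comm] using (hφ.opCoop hε hS).2.2 a b

/-- Strong invariance of $\psi$, read off from `opCoop`, where $\psi$ is a left integral and $S$ is
still the antipode. -/
theorem IsIntegral.antipode_sliceLeft (hφ : H.IsIntegral φ) (hε : H.IsCounit ε)
    (hS : H.IsAntipode ε S.toLinearMap) (z : V ⊗[ℂ] V) :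
    S (sliceLeft (φ ∘ₗ S.toLinearMap) (H.T₂ z)) =
      sliceLeft (φ ∘ₗ S.toLinearMap) (H.T₃ z) := by
  simpa [HopfData.opCoop, sliceRight_comm] using
    (hφ.opCoop hε hS).antipode_sliceRight hε.opCoop (hS.opCoop hε) (TensorProduct.comm ℂ V V z)

/-- Strong invariance of $\varphi$ moves $\Delta$ from $c$ to $x$, and that of $\psi$ moves it from
$x$ to $a$. This turns a right translate of $\varphi$ into a left translate of $\psi$; slices of
bijections being onto, all translates arise. -/
theorem IsIntegral.apply_mul_sliceLeft (hφ : H.IsIntegral φ) (hε : H.IsCounit ε)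
    (hS : H.IsAntipode ε S.toLinearMap) (a c x : V) :
    φ (H.m x (sliceLeft φ (H.T₃ (c ⊗ₜ S a)))) = φ (S (H.m
      (sliceRight (φ ∘ₗ S.symm.toLinearMap) (H.T₄ (S c ⊗ₜ a))) x)) := by
  set ψ : Module.Dual ℂ V := φ ∘ₗ S.toLinearMap with hψ
  have hmul (a b : V) : S (H.m a b) = H.m (S b) (S a) := hS.map_mul hε a b
  have h₁ : φ (H.m x (sliceLeft φ (H.T₃ (c ⊗ₜ S a)))) =
      ψ (H.m a (sliceRight φ (H.T₁ (x ⊗ₜ c)))) := by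
    have e : S (sliceRight φ (H.T₁ (x ⊗ₜ c))) = sliceRight φ (H.T₄ (x ⊗ₜ c)) :=
      hφ.antipode_sliceRight hε hS (x ⊗ₜ c)
    rw [hψ, LinearMap.comp_apply, LinearEquiv.coe_coe, hmul, e,
      ← sliceLeft_onSnd, apply_sliceLeft, H.T₃_T₄, sliceRight_onFst]
    simp
  have h₂ : ψ (H.m a (sliceRight φ (H.T₁ (x ⊗ₜ c)))) =
      φ (H.m (sliceLeft ψ (H.T₂ (a ⊗ₜ x))) c) := by
    rw [← sliceRight_onFst, H.T₁_T₂, ← apply_sliceLeft, sliceLeft_onSnd]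
    simp
  have h₃ : φ (H.m (sliceLeft ψ (H.T₂ (a ⊗ₜ x))) c) =
      (φ ∘ₗ S.symm.toLinearMap) (H.m (S c) (sliceLeft ψ (H.T₃ (a ⊗ₜ x)))) := by
    rw [← hφ.antipode_sliceLeft hε hS, ← hmul]
    simp [hψ]
  have h₄ : (φ ∘ₗ S.symm.toLinearMap) (H.m (S c) (sliceLeft ψ (H.T₃ (a ⊗ₜ x)))) =
      ψ (H.m (sliceRight (φ ∘ₗ S.symm.toLinearMap) (H.T₄ (S c ⊗ₜ a))) x) := by
    rw [← sliceLeft_onSnd, H.T₃_T₄, apply_sliceLeft, sliceRight_onFst]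
    simp
  rw [h₁, h₂, h₃, h₄]
  rfl

theorem IsIntegral.apply_mul_sliceLeft' (hφ : H.IsIntegral φ) (hε : H.IsCounit ε)
    (hS : H.IsAntipode ε S.toLinearMap) (w : V ⊗[ℂ] V) (x : V) :
    φ (H.m x (sliceLeft φ (H.T₃ w))) = φ (S (H.m (sliceRight (φ ∘ₗ S.symm.toLinearMap)
      (H.T₄ (TensorProduct.map S.toLinearMap S.symm.toLinearMap w))) x)) := by
  induction w with
  | zero => simp
  | add x y hx hy => simp only [map_add, LinearMap.add_apply, hx, hy]
  | tmul c a => simpa using hφ.apply_mul_sliceLeft hε hS (S.symm a) c x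

/-- The case "$x=1$" of the preceding identity, proved separately from invariance. It makes the
counit of the dual independent of how a functional is represented. -/
theorem IsIntegral.apply_sliceLeft_eq (hφ : H.IsIntegral φ) (hε : H.IsCounit ε)
    (hS : H.IsAntipode ε S.toLinearMap) (w : V ⊗[ℂ] V) :
    φ (sliceLeft φ (H.T₃ w)) = φ (S (sliceRight (φ ∘ₗ S.symm.toLinearMap)
      (H.T₄ (TensorProduct.map S.toLinearMap S.symm.toLinearMap w)))) := by
  induction w with
  | zero => simp
  | add x y hx hy => simp only [map_add, hx, hy]
  | tmul c a =>
    have h := apply_sliceLeft (φ ∘ₗ S.toLinearMap) (φ ∘ₗ S.symm.toLinearMap)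
      (H.T₄ (S c ⊗ₜ S.symm a))
    rw [hφ.sliceLeft_T₄ hε hS] at h
    rw [apply_sliceLeft, hφ.2.1]
    simpa [mul_comm] using h

theorem IsIntegral.ne_zero_comp_symm (hφ : H.IsIntegral φ) :
    φ ∘ₗ S.symm.toLinearMap ≠ 0 := fun h => hφ.1 <| LinearMap.ext fun x => by
  simpa using LinearMap.congr_fun h (S x)

/-- Every functional `φ(· a)` is of the form `ψ(v ·)` where `ψ = φ ∘ S`. -/
theorem IsIntegral.exists_left_of_right (hφ : H.IsIntegral φ) (hε : H.IsCounit ε)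
    (hS : H.IsAntipode ε S.toLinearMap) (a : V) :
    ∃ v, (∀ x, φ (H.m x a) = φ (S (H.m v x))) ∧ φ a = φ (S v) := by
  obtain ⟨w, rfl⟩ := sliceLeft_surjective hφ.1 a
  obtain ⟨w, rfl⟩ := H.T₃.surjective w
  exact ⟨_, hφ.apply_mul_sliceLeft' hε hS w, hφ.apply_sliceLeft_eq hε hS w⟩

theorem IsIntegral.exists_right_of_left (hφ : H.IsIntegral φ) (hε : H.IsCounit ε)
    (hS : H.IsAntipode ε S.toLinearMap) (v : V) :
    ∃ a, (∀ x, φ (H.m x a) = φ (S (H.m v x))) ∧ φ a = φ (S v) := by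
  obtain ⟨w, rfl⟩ := sliceRight_surjective (hφ.ne_zero_comp_symm (S := S)) v
  obtain ⟨w, rfl⟩ := H.T₄.surjective w
  obtain ⟨w, rfl⟩ := (TensorProduct.congr S S.symm).surjective w
  exact ⟨_, hφ.apply_mul_sliceLeft' hε hS w, hφ.apply_sliceLeft_eq hε hS w⟩

/-- Both sides equal $(\psi\otimes\varphi)(\Delta(x)z)$ with $z=T_3w=T_1w'$: left invariance of
$\varphi$ evaluates it through $T_3$, right invariance of $\psi$ through $T_1$. -/
theorem IsIntegral.apply_mul_sliceRight (hφ : H.IsIntegral φ) (hε : H.IsCounit ε)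
    (hS : H.IsAntipode ε S.toLinearMap) {w w' : V ⊗[ℂ] V} (h : H.T₃ w = H.T₁ w') (x : V) :
    φ (H.m x (sliceRight (φ ∘ₗ S.toLinearMap) w)) = φ (S (H.m x (sliceRight φ w'))) := by
  have h₁ : φ ∘ₗ H.m x ∘ₗ sliceRight (φ ∘ₗ S.toLinearMap) =
      (φ ∘ₗ S.toLinearMap) ∘ₗ sliceRight φ ∘ₗ H.dl x ∘ₗ H.T₃.toLinearMap := by
    refine TensorProduct.ext' fun p q => ?_
    simp [H.dl_T₃, hφ.2.1, mul_comm]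
  have h₂ : (φ ∘ₗ S.toLinearMap) ∘ₗ H.m x ∘ₗ sliceRight φ =
      φ ∘ₗ sliceLeft (φ ∘ₗ S.toLinearMap) ∘ₗ H.dl x ∘ₗ H.T₁.toLinearMap := by
    refine TensorProduct.ext' fun p q => ?_
    simp [H.dl_T₁, hφ.sliceLeft_T₁ hε hS, mul_comm]
  have e₁ := LinearMap.congr_fun h₁ w
  have e₂ := LinearMap.congr_fun h₂ w'
  simp only [LinearMap.comp_apply, LinearEquiv.coe_coe, h] at e₁ e₂
  rw [e₁, e₂, apply_sliceLeft]
  rfl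

/-- The functionals `φ(· a)` and the functionals `ψ(· a)`, where `ψ = φ ∘ S`, are the same. -/
theorem IsIntegral.exists_comp_antipode (hφ : H.IsIntegral φ) (hε : H.IsCounit ε)
    (hS : H.IsAntipode ε S.toLinearMap) (a : V) : ∃ a', ∀ x, φ (H.m x a) = φ (S (H.m x a')) := by
  obtain ⟨w, rfl⟩ := sliceRight_surjective (hφ.opCoop hε hS).1 a
  exact ⟨_, hφ.apply_mul_sliceRight hε hS (H.T₁.apply_symm_apply (H.T₃ w)).symm⟩

theorem IsIntegral.exists_of_comp_antipode (hφ : H.IsIntegral φ) (hε : H.IsCounit ε)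
    (hS : H.IsAntipode ε S.toLinearMap) (a : V) :
    ∃ a', ∀ x, φ (H.m x a') = φ (S (H.m x a)) := by
  obtain ⟨w, rfl⟩ := sliceRight_surjective hφ.1 a
  exact ⟨_, hφ.apply_mul_sliceRight hε hS (H.T₃.apply_symm_apply (H.T₁ w))⟩

end Equiv

end HopfData

/-! ### From the multiplier algebra to `HopfData`. -/

section Multipliers

variable {R : Type*} [NonUnitalRing R] [Module ℂ R] [IsScalarTower ℂ R R] [SMulCommClass ℂ R R]

theorem rightMul_mul (hR : NondegenerateProduct R) (m : MultiplierAlgebra R) (x y : R) :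
    rightMul m (x * y) = x * rightMul m y := by
  rw [← sub_eq_zero]
  refine hR.1 _ fun z => ?_
  rw [sub_mul, rightMul_mul_eq, mul_assoc, mul_assoc, rightMul_mul_eq, sub_self]

theorem ofElem_injective (hR : NondegenerateProduct R) {r s : R} (h : ofElem r = ofElem s) :
    r = s := by
  rw [← sub_eq_zero]
  refine hR.1 _ fun b => ?_
  rw [sub_mul, sub_eq_zero]
  exact congrArg (fun m => leftMul m b) h

theorem ofElem_leftMul (hR : NondegenerateProduct R) (m : MultiplierAlgebra R) (r : R) :
    ofElem (leftMul m r) = m * ofElem r := by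
  refine Subtype.ext (Prod.ext (LinearMap.ext fun x => ?_)
    (MulOpposite.unop_injective (LinearMap.ext fun x => ?_)))
  · exact (leftMul_mul hR m r x).symm
  · exact (rightMul_mul_eq m x r).symm

theorem ofElem_rightMul (hR : NondegenerateProduct R) (m : MultiplierAlgebra R) (r : R) :
    ofElem (rightMul m r) = ofElem r * m := by
  refine Subtype.ext (Prod.ext (LinearMap.ext fun x => ?_)
    (MulOpposite.unop_injective (LinearMap.ext fun x => ?_)))
  · exact rightMul_mul_eq m r x
  · exact (rightMul_mul hR m x r).symm

end Multipliers

section Tensor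

variable {A : Type*} [NonUnitalRing A] [Module ℂ A] [IsScalarTower ℂ A A] [SMulCommClass ℂ A A]

theorem tmulOne_mul_oneTmul (a b : A) : tmulOne a * oneTmul b = ofElem (a ⊗ₜ[ℂ] b) := by
  refine Subtype.ext (Prod.ext (TensorProduct.ext' fun x y => ?_)
    (MulOpposite.unop_injective (TensorProduct.ext' fun x y => ?_)))
  · simp [tmulOne, oneTmul, ofElem]
  · simp [tmulOne, oneTmul, ofElem]

theorem oneTmul_mul_tmulOne (a b : A) : oneTmul b * tmulOne a = ofElem (a ⊗ₜ[ℂ] b) := by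
  refine Subtype.ext (Prod.ext (TensorProduct.ext' fun x y => ?_)
    (MulOpposite.unop_injective (TensorProduct.ext' fun x y => ?_)))
  · simp [tmulOne, oneTmul, ofElem]
  · simp [tmulOne, oneTmul, ofElem]

theorem tensorFunctional_eq_sliceLeft (ω ω' : Module.Dual ℂ A) (z : A ⊗[ℂ] A) :
    tensorFunctional ω ω' z = ω' (sliceLeft ω z) := by
  induction z with
  | zero => simp
  | add x y hx hy => simp only [map_add, hx, hy]
  | tmul a b => simp

theorem tensorFunctional_eq_sliceRight (ω ω' : Module.Dual ℂ A) (z : A ⊗[ℂ] A) :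
    tensorFunctional ω ω' z = ω (sliceRight ω' z) := by
  rw [tensorFunctional_eq_sliceLeft, apply_sliceLeft]

end Tensor

namespace RegularMultiplierHopfAlgebra

variable {A : Type*} [NonUnitalRing A] [Module ℂ A] [IsScalarTower ℂ A A] [SMulCommClass ℂ A A]
  (H : RegularMultiplierHopfAlgebra A)

theorem eq_of_ofElem (H : RegularMultiplierHopfAlgebra A) {y z : A ⊗[ℂ] A}
    (h : ofElem y = ofElem z) : y = z :=
  ofElem_injective H.nondegenerate.tensor h

theorem T₁_T₂ (a b c : A) : leftMul (tmulOne a) (H.T₁ (b ⊗ₜ c)) =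
    rightMul (oneTmul c) (H.T₂ (a ⊗ₜ b)) := H.eq_of_ofElem <| by
  rw [ofElem_leftMul H.nondegenerate.tensor, ofElem_rightMul H.nondegenerate.tensor, H.of_T₁,
    H.of_T₂, mul_assoc]

theorem T₃_T₄ (a b c : A) : leftMul (oneTmul a) (H.T₃ (b ⊗ₜ c)) =
    rightMul (tmulOne c) (H.T₄ (a ⊗ₜ b)) := H.eq_of_ofElem <| by
  rw [ofElem_leftMul H.nondegenerate.tensor, ofElem_rightMul H.nondegenerate.tensor, H.of_T₃,
    H.of_T₄, mul_assoc]

theorem T₃_T₂ (a b c : A) : leftMul (tmulOne a) (H.T₃ (b ⊗ₜ c)) =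
    rightMul (tmulOne c) (H.T₂ (a ⊗ₜ b)) := H.eq_of_ofElem <| by
  rw [ofElem_leftMul H.nondegenerate.tensor, ofElem_rightMul H.nondegenerate.tensor, H.of_T₃,
    H.of_T₂, mul_assoc]

theorem T₁_T₄ (a b c : A) : leftMul (oneTmul a) (H.T₁ (b ⊗ₜ c)) =
    rightMul (oneTmul c) (H.T₄ (a ⊗ₜ b)) := H.eq_of_ofElem <| by
  rw [ofElem_leftMul H.nondegenerate.tensor, ofElem_rightMul H.nondegenerate.tensor, H.of_T₁,
    H.of_T₄, mul_assoc]

theorem right_tmul_eq_T₂ (a c c' : A) : rightMul (H.Δ a) (c ⊗ₜ c') =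
    leftMul (oneTmul c') (H.T₂ (c ⊗ₜ a)) := H.eq_of_ofElem <| by
  rw [ofElem_leftMul H.nondegenerate.tensor, ofElem_rightMul H.nondegenerate.tensor, H.of_T₂,
    ← mul_assoc, oneTmul_mul_tmulOne]

theorem right_tmul_eq_T₄ (a c c' : A) : rightMul (H.Δ a) (c ⊗ₜ c') =
    leftMul (tmulOne c) (H.T₄ (c' ⊗ₜ a)) := H.eq_of_ofElem <| by
  rw [ofElem_leftMul H.nondegenerate.tensor, ofElem_rightMul H.nondegenerate.tensor, H.of_T₄,
    ← mul_assoc, tmulOne_mul_oneTmul]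

theorem left_T₁ (a p q : A) : leftMul (H.Δ a) (H.T₁ (p ⊗ₜ q)) = H.T₁ ((a * p) ⊗ₜ q) :=
  H.eq_of_ofElem <| by
    rw [ofElem_leftMul H.nondegenerate.tensor, H.of_T₁, H.of_T₁, map_mul, mul_assoc]

theorem right_T₂ (a p q : A) : rightMul (H.Δ a) (H.T₂ (p ⊗ₜ q)) = H.T₂ (p ⊗ₜ (q * a)) :=
  H.eq_of_ofElem <| by
    rw [ofElem_rightMul H.nondegenerate.tensor, H.of_T₂, H.of_T₂, map_mul, mul_assoc]

theorem right_T₄ (a p q : A) : rightMul (H.Δ a) (H.T₄ (p ⊗ₜ q)) = H.T₄ (p ⊗ₜ (q * a)) :=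
  H.eq_of_ofElem <| by
    rw [ofElem_rightMul H.nondegenerate.tensor, H.of_T₄, H.of_T₄, map_mul, mul_assoc]

theorem assoc_onFst_T₁ (a b c : A) :
    TensorProduct.assoc ℂ A A A (onFst (fixFst H.T₂.toLinearMap a) (H.T₁ (b ⊗ₜ c))) =
      onSnd (fixSnd H.T₁.toLinearMap c) (H.T₂ (a ⊗ₜ b)) := by
  have h₁ : ∀ z : A ⊗[ℂ] A, TensorProduct.map H.T₂.toLinearMap LinearMap.id
      ((TensorProduct.assoc ℂ A A A).symm (a ⊗ₜ z)) = onFst (fixFst H.T₂.toLinearMap a) z := by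
    intro z
    induction z with
    | zero => simp
    | add x y hx hy => simp only [map_add, TensorProduct.tmul_add, hx, hy]
    | tmul x y => simp
  rw [← h₁, H.coassoc, LinearEquiv.apply_symm_apply]
  exact HopfData.onSnd_assoc_tmul _ _ _

/-- The second coassociativity law follows from the first: multiplying by $d$ on the left of the
first leg and by $f$ on the right of the third trades $T_3$ for $T_2$ and $T_4$ for $T_1$.
Non-degeneracy then removes $d$ and $f$. -/
theorem assoc_onFst_T₄ (a b c : A) :
    TensorProduct.assoc ℂ A A A (onFst (fixSnd H.T₃.toLinearMap a) (H.T₄ (c ⊗ₜ b))) =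
      onSnd (fixFst H.T₄.toLinearMap c) (H.T₃ (b ⊗ₜ a)) := by
  refine onFst_injective (fun d => LinearMap.mulLeft ℂ d) (fun w hw => H.nondegenerate.2 w hw)
    fun d => onSnd_injective (fun f : A => onSnd (LinearMap.mulRight ℂ f))
      (fun w hw => eq_zero_of_mulRight_snd H.nondegenerate w hw) fun f => ?_
  have e₁ : onFst (LinearMap.mulLeft ℂ d) ∘ₗ fixSnd H.T₃.toLinearMap a =
      onFst (LinearMap.mulRight ℂ a) ∘ₗ fixFst H.T₂.toLinearMap d :=
    LinearMap.ext fun x => H.T₃_T₂ d x a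
  have e₂ : onSnd (LinearMap.mulRight ℂ f) ∘ₗ fixFst H.T₄.toLinearMap c =
      onSnd (LinearMap.mulLeft ℂ c) ∘ₗ fixSnd H.T₁.toLinearMap f :=
    LinearMap.ext fun x => (H.T₁_T₄ c x f).symm
  have e₃ : onSnd (LinearMap.mulRight ℂ f) (H.T₄ (c ⊗ₜ b)) =
      onSnd (LinearMap.mulLeft ℂ c) (H.T₁ (b ⊗ₜ f)) := (H.T₁_T₄ c b f).symm
  have e₄ : onFst (LinearMap.mulLeft ℂ d) (H.T₃ (b ⊗ₜ a)) =
      onFst (LinearMap.mulRight ℂ a) (H.T₂ (d ⊗ₜ b)) := H.T₃_T₂ d b a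
  rw [onFst_assoc, onFst_onFst, e₁, onSnd_onSnd_assoc, ← onFst_onSnd, e₃, ← onFst_onFst,
    onFst_onSnd, onFst_onSnd, ← onSnd_onSnd_assoc, ← onFst_assoc, assoc_onFst_T₁, onFst_onSnd,
    onFst_onSnd (LinearMap.mulLeft ℂ d) (fixFst H.T₄.toLinearMap c), e₄, onSnd_onSnd, onSnd_onSnd,
    e₂]

/-- The product of `A` and the four maps of a regular multiplier Hopf algebra. -/
def toHopfData : HopfData A where
  m := LinearMap.mul ℂ A
  assoc := mul_assoc
  nondeg_left := H.nondegenerate.1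
  nondeg_right := H.nondegenerate.2
  T₁ := H.T₁
  T₂ := H.T₂
  T₃ := H.T₃
  T₄ := H.T₄
  dl a := leftMul (H.Δ a)
  dr a := rightMul (H.Δ a)
  dl_eq_T₁ := H.left_tmul_eq_T₁
  dl_eq_T₃ := H.left_tmul_eq_T₃
  dr_eq_T₂ := H.right_tmul_eq_T₂
  dr_eq_T₄ := H.right_tmul_eq_T₄
  dl_T₁ := H.left_T₁
  dl_T₃ := H.left_T₃
  dr_T₂ := H.right_T₂
  dr_T₄ := H.right_T₄
  T₁_T₂ := H.T₁_T₂
  T₃_T₄ := H.T₃_T₄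
  T₃_T₂ := H.T₃_T₂
  T₁_T₄ := H.T₁_T₄
  coassoc := H.assoc_onFst_T₁
  coassoc' := H.assoc_onFst_T₄

end RegularMultiplierHopfAlgebra

/-! ### Product formulas in the dual, and the descriptions of its underlying space. -/

namespace RegularMultiplierHopfAlgebra

variable {A : Type*} [NonUnitalRing A] [Module ℂ A] [IsScalarTower ℂ A A] [SMulCommClass ℂ A A]

section Slices

variable (ω : Module.Dual ℂ A) (a : A) (z : A ⊗[ℂ] A)

theorem sliceLeft_leftMul_oneTmul : sliceLeft ω (leftMul (oneTmul a) z) = a * sliceLeft ω z :=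
  sliceLeft_map ω _ (LinearMap.mulLeft ℂ a) z

theorem sliceLeft_rightMul_oneTmul : sliceLeft ω (rightMul (oneTmul a) z) = sliceLeft ω z * a :=
  sliceLeft_map ω _ (LinearMap.mulRight ℂ a) z

theorem sliceRight_leftMul_tmulOne :
    sliceRight ω (leftMul (tmulOne a) z) = a * sliceRight ω z :=
  sliceRight_map ω (LinearMap.mulLeft ℂ a) _ z

theorem sliceRight_rightMul_tmulOne :
    sliceRight ω (rightMul (tmulOne a) z) = sliceRight ω z * a :=
  sliceRight_map ω (LinearMap.mulRight ℂ a) _ z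

end Slices

variable {H : RegularMultiplierHopfAlgebra A} {φ ε : Module.Dual ℂ A} {S : A ≃ₗ[ℂ] A}

theorem IsLeftIntegral.isIntegral (hφ : H.IsLeftIntegral φ) : H.toHopfData.IsIntegral φ := hφ

theorem IsLeftIntegral.nontrivial (hφ : H.IsLeftIntegral φ) : Nontrivial A := by
  by_contra h
  rw [not_nontrivial_iff_subsingleton] at h
  exact hφ.1 (LinearMap.ext fun x => by rw [Subsingleton.elim x 0, map_zero, map_zero])

section

variable [Nontrivial A]

/-- Here $b$ is the image of $\varphi(\,\cdot\,c)$ under the dual antipode. Strong invariance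
removes the $S$ in $b$ and moves $\Delta$ from $x$ to $a$. It serves both part (1) and the first
antipode law of the dual. -/
theorem IsLeftIntegral.dualMul_comp_antipode (hφ : H.IsLeftIntegral φ)
    (hε : H.toHopfData.IsCounit ε) (hS : H.toHopfData.IsAntipode ε S.toLinearMap)
    {b b' : dualSpace φ} {c a : A} (hb : ∀ x, (b : Module.Dual ℂ A) x = φ (S x * c))
    (hb' : ∀ x, (b' : Module.Dual ℂ A) x = φ (x * a)) (x : A) :
    (hφ.dualMul b b' : Module.Dual ℂ A) x = φ (x * sliceLeft φ (H.T₃ (a ⊗ₜ c))) := by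
  have e : S (sliceRight φ (H.T₁ (x ⊗ₜ a))) = sliceRight φ (H.T₄ (x ⊗ₜ a)) :=
    hφ.isIntegral.antipode_sliceRight hε hS (x ⊗ₜ a)
  rw [hφ.dualMul_tmul b b' x a (LinearMap.ext hb'), tensorFunctional_eq_sliceRight, hb, e,
    ← sliceRight_rightMul_tmulOne, ← H.T₃_T₄, ← apply_sliceLeft, sliceLeft_leftMul_oneTmul]

theorem IsLeftIntegral.dualMul_comp_antipode_left (hφ : H.IsLeftIntegral φ)
    {b b' : dualSpace φ} {p : A} (hb : ∀ x, (b : Module.Dual ℂ A) x = φ (S (p * x))) (x : A) :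
    (hφ.dualMul b b' : Module.Dual ℂ A) x =
      (b' : Module.Dual ℂ A) (sliceLeft (φ ∘ₗ S.toLinearMap) (H.T₂ (p ⊗ₜ x))) := by
  obtain ⟨c, hc⟩ := b'.2
  have hc' (y : A) : (b' : Module.Dual ℂ A) y = φ (y * c) := by rw [← hc]; rfl
  rw [hφ.dualMul_tmul b b' x c hc.symm, tensorFunctional_eq_sliceRight, hb,
    ← sliceRight_leftMul_tmulOne, H.T₁_T₂, hc', ← sliceLeft_rightMul_oneTmul, apply_sliceLeft]
  rfl

/-- The mirror image of `dualMul_comp_antipode`, with $\psi$ and left translates. It serves the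
second antipode law of the dual. -/
theorem IsLeftIntegral.dualMul_comp_antipode_right (hφ : H.IsLeftIntegral φ)
    (hε : H.toHopfData.IsCounit ε) (hS : H.toHopfData.IsAntipode ε S.toLinearMap)
    {b b' : dualSpace φ} {p q : A} (hb : ∀ x, (b : Module.Dual ℂ A) x = φ (S (p * x)))
    (hb' : ∀ x, (b' : Module.Dual ℂ A) x = φ (S (q * S x))) (x : A) :
    (hφ.dualMul b b' : Module.Dual ℂ A) x =
      φ (S (sliceRight (φ ∘ₗ S.toLinearMap) (H.T₄ (q ⊗ₜ p)) * x)) := by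
  have e : S (sliceLeft (φ ∘ₗ S.toLinearMap) (H.T₂ (p ⊗ₜ x))) =
      sliceLeft (φ ∘ₗ S.toLinearMap) (H.T₃ (p ⊗ₜ x)) :=
    hφ.isIntegral.antipode_sliceLeft hε hS (p ⊗ₜ x)
  rw [hφ.dualMul_comp_antipode_left hb, hb', e, ← sliceLeft_leftMul_oneTmul, H.T₃_T₄,
    ← sliceRight_rightMul_tmulOne]
  exact apply_sliceLeft (φ ∘ₗ S.toLinearMap) (φ ∘ₗ S.toLinearMap) _

/-- The product formula behind part (2). Applying $S\otimes S$ to $\Delta(x)(c\otimes1)$ turns it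
into $\Delta(S(x))$, and strong invariance of $\psi$ then leads to $\Delta(a)(1\otimes c)$. -/
theorem IsLeftIntegral.dualMul_rightTranslate (hφ : H.IsLeftIntegral φ)
    (hε : H.toHopfData.IsCounit ε) (hS : H.toHopfData.IsAntipode ε S.toLinearMap)
    {b b' : dualSpace φ} {c a : A} (hb : ∀ x, (b : Module.Dual ℂ A) x = φ (x * c))
    (hb' : ∀ x, (b' : Module.Dual ℂ A) x = φ (S (S x * a))) (x : A) :
    (hφ.dualMul b b' : Module.Dual ℂ A) x = φ (S (S x * sliceRight φ (H.T₁ (a ⊗ₜ c)))) := by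
  let ψ : Module.Dual ℂ A := φ ∘ₗ S.toLinearMap
  have hmul (p q : A) : S (p * q) = S q * S p := hS.map_mul hε p q
  have h₁ : ∀ z : A ⊗[ℂ] A, tensorFunctional φ (b' : Module.Dual ℂ A) z =
      ψ (sliceLeft (φ ∘ₗ S.symm.toLinearMap)
        (TensorProduct.map S.toLinearMap S.toLinearMap z) * a) := by
    intro z
    induction z with
    | zero => simp
    | add x y hx hy => simp only [map_add, add_mul, hx, hy]
    | tmul p q => simp [hb', ψ, smul_mul_assoc]
  have h₂ : TensorProduct.map S.toLinearMap S.toLinearMap (H.T₃ (x ⊗ₜ c)) =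
      TensorProduct.comm ℂ A A (H.T₄ (S c ⊗ₜ S x)) := hS.map_T₃ hε x c
  have h₃ : S (sliceLeft ψ (H.T₂ (S x ⊗ₜ a))) = sliceLeft ψ (H.T₃ (S x ⊗ₜ a)) :=
    hφ.isIntegral.antipode_sliceLeft hε hS (S x ⊗ₜ a)
  have h₄ : ψ (sliceRight (φ ∘ₗ S.symm.toLinearMap) (H.T₄ (S c ⊗ₜ S x)) * a) =
      φ (sliceLeft ψ (H.T₂ (S x ⊗ₜ a)) * c) := by
    rw [← sliceRight_rightMul_tmulOne, ← H.T₃_T₄, ← apply_sliceLeft, sliceLeft_leftMul_oneTmul,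
      ← h₃, ← hmul]
    simp
  rw [hφ.dualMul_tmul' b b' x c (LinearMap.ext hb), h₁, h₂, sliceLeft_comm, h₄,
    ← sliceLeft_rightMul_oneTmul, ← H.T₁_T₂, apply_sliceLeft, sliceRight_leftMul_tmulOne]
  rfl

/-- The functionals `φ(· a)`, the functionals `ψ(v ·)` and the functionals `ψ(S(·)a)`, where
`ψ = φ ∘ S`, form the same space, and this space is invariant under the antipode. -/
theorem IsLeftIntegral.exists_equivs (hφ : H.IsLeftIntegral φ)
    (hε : H.toHopfData.IsCounit ε) (hS : H.toHopfData.IsAntipode ε S.toLinearMap) :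
    ∃ (F G Q : A ≃ₗ[ℂ] dualSpace φ) (SB : dualSpace φ ≃ₗ[ℂ] dualSpace φ),
      (∀ a x : A, (F a : Module.Dual ℂ A) x = φ (x * a)) ∧
      (∀ a x : A, (G a : Module.Dual ℂ A) x = φ (S (S x * a))) ∧
      (∀ a x : A, (Q a : Module.Dual ℂ A) x = φ (S (a * x))) ∧
      (∀ v, φ (F.symm (Q v)) = φ (S v)) ∧
      ∀ (b : dualSpace φ) (x : A),
        (SB b : Module.Dual ℂ A) x = (b : Module.Dual ℂ A) (S x) := by
  have hI := hφ.isIntegral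
  have hmul (p q : A) : S (p * q) = S q * S p := hS.map_mul hε p q
  have faithful {a : A} (h : ∀ x, φ (x * a) = 0) : a = 0 := hI.faithful h
  have faithful' {a : A} (h : ∀ x, φ (a * x) = 0) : a = 0 := hI.op.faithful h
  have exL (a : A) : ∃ v, (∀ x, φ (x * a) = φ (S (v * x))) ∧ φ a = φ (S v) :=
    hI.exists_left_of_right hε hS a
  have exR (v : A) : ∃ a, (∀ x, φ (x * a) = φ (S (v * x))) ∧ φ a = φ (S v) :=
    hI.exists_right_of_left hε hS v
  have exC (a : A) : ∃ a', ∀ x, φ (x * a) = φ (S (x * a')) := hI.exists_comp_antipode hε hS a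
  have exC' (a : A) : ∃ a', ∀ x, φ (x * a') = φ (S (x * a)) := hI.exists_of_comp_antipode hε hS a
  have memS {b : Module.Dual ℂ A} (hb : b ∈ dualSpace φ) : b ∘ₗ S.toLinearMap ∈ dualSpace φ := by
    obtain ⟨a, rfl⟩ := hb
    -- Since $\varphi(S(x)a)=\psi(S^{-1}(a)x)$, composition with $S$ gives a left translate of
    -- $\psi$.
    obtain ⟨a', ha', -⟩ := exR (S.symm a)
    refine ⟨a', LinearMap.ext fun x => ?_⟩
    simpa [rightTranslate, hmul] using ha' x
  let F : A ≃ₗ[ℂ] dualSpace φ := LinearEquiv.ofInjective (rightTranslate φ) <| by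
    rw [injective_iff_map_eq_zero]
    exact fun a ha => faithful fun x => LinearMap.congr_fun ha x
  have hF (a x : A) : (F a : Module.Dual ℂ A) x = φ (x * a) := rfl
  let g : A →ₗ[ℂ] dualSpace φ := LinearMap.codRestrict (dualSpace φ)
    (LinearMap.mk₂ ℂ (fun a x => φ (S (S x * a))) (by simp [mul_add]) (by simp [mul_smul_comm])
      (by simp [add_mul]) (by simp [smul_mul_assoc])) fun a => by
    obtain ⟨a', ha'⟩ := exC' a
    have := memS (b := rightTranslate φ a') ⟨a', rfl⟩
    convert this using 1
    ext x
    exact (ha' (S x)).symm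
  have hg (a x : A) : (g a : Module.Dual ℂ A) x = φ (S (S x * a)) := rfl
  let q : A →ₗ[ℂ] dualSpace φ := LinearMap.codRestrict (dualSpace φ)
    (LinearMap.mk₂ ℂ (fun a x => φ (S (a * x))) (by simp [add_mul]) (by simp [smul_mul_assoc])
      (by simp [mul_add]) (by simp [mul_smul_comm])) fun v => by
    obtain ⟨a, ha, -⟩ := exR v
    exact ⟨a, LinearMap.ext ha⟩
  have hq (a x : A) : (q a : Module.Dual ℂ A) x = φ (S (a * x)) := rfl
  let s : dualSpace φ →ₗ[ℂ] dualSpace φ := LinearMap.restrict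
    (LinearMap.lcomp ℂ ℂ S.toLinearMap) fun b hb => memS hb
  have hs (b : dualSpace φ) (x : A) : (s b : Module.Dual ℂ A) x = (b : Module.Dual ℂ A) (S x) := rfl
  have g_bij : Function.Bijective g := by
    refine ⟨?_, fun b => ?_⟩
    · rw [injective_iff_map_eq_zero]
      -- As $\psi(S(y)a)=\varphi(S(a)S^2(y))$, evaluation at $y=S^{-2}(x)$ gives $\varphi(S(a)x)=0$.
      refine fun a ha => S.map_eq_zero_iff.1 (faithful' fun x => ?_)
      have := hg a (S.symm (S.symm x))
      rw [ha] at this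
      simpa [hmul] using this.symm
    · obtain ⟨a, rfl⟩ := F.surjective b
      obtain ⟨v, hv, -⟩ := exL a
      obtain ⟨a', ha'⟩ := exC (S v)
      refine ⟨a', Subtype.ext (LinearMap.ext fun x => ?_)⟩
      rw [hg, hF, hv, hmul v, ha']
  have q_bij : Function.Bijective q := by
    refine ⟨?_, fun b => ?_⟩
    · rw [injective_iff_map_eq_zero]
      refine fun a ha => S.map_eq_zero_iff.1 (faithful fun x => ?_)
      have := hq a (S.symm x)
      rw [ha] at this
      simpa [hmul] using this.symm
    · obtain ⟨a, rfl⟩ := F.surjective b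
      obtain ⟨v, hv, -⟩ := exL a
      exact ⟨v, Subtype.ext (LinearMap.ext fun x => (hv x).symm)⟩
  have s_bij : Function.Bijective s := by
    refine ⟨?_, fun b => ?_⟩
    · rw [injective_iff_map_eq_zero]
      refine fun b hb => Subtype.ext (LinearMap.ext fun x => ?_)
      have := hs b (S.symm x)
      rw [hb] at this
      simpa using this.symm
    · obtain ⟨a, rfl⟩ := F.surjective b
      obtain ⟨v, hv, -⟩ := exL a
      refine ⟨F (S v), Subtype.ext (LinearMap.ext fun x => ?_)⟩
      rw [hs, hF, hF, hv, hmul]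
  refine ⟨F, LinearEquiv.ofBijective g g_bij, LinearEquiv.ofBijective q q_bij,
    LinearEquiv.ofBijective s s_bij, hF, hg, hq, fun v => ?_, hs⟩
  obtain ⟨a, ha, ha'⟩ := exR v
  have : LinearEquiv.ofBijective q q_bij v = F a :=
    Subtype.ext (LinearMap.ext fun x => (ha x).symm)
  rw [this, F.symm_apply_apply, ha']

end

theorem tensorPairing_injective : Function.Injective
    fun (w : dualSpace φ ⊗[ℂ] dualSpace φ) (a : A) (a' : A) => tensorPairing φ w (a ⊗ₜ a') := by
  intro w w' h
  let ev (a : A) : dualSpace φ →ₗ[ℂ] ℂ := LinearMap.applyₗ a ∘ₗ (dualSpace φ).subtype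
  have hev (b : dualSpace φ) (hb : ∀ a, ev a b = 0) : b = 0 := Subtype.ext (LinearMap.ext hb)
  refine onFst_injective ev hev fun a => onSnd_injective ev hev fun a' => ?_
  apply (TensorProduct.lid ℂ ℂ).injective
  have key : ∀ w : dualSpace φ ⊗[ℂ] dualSpace φ,
      TensorProduct.lid ℂ ℂ (onSnd (ev a') (onFst (ev a) w)) = tensorPairing φ w (a ⊗ₜ a') := by
    intro w
    induction w with
    | zero => simp
    | add x y hx hy => simp only [map_add, LinearMap.add_apply, hx, hy]
    | tmul b b' => simp [ev, tensorPairing]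
  rw [key, key]
  exact congrFun (congrFun h a) a'

theorem tensorPairing_tmul (b b' : dualSpace φ) (z : A ⊗[ℂ] A) :
    tensorPairing φ (b ⊗ₜ b') z = tensorFunctional (b : Module.Dual ℂ A) b' z := by
  induction z with
  | zero => simp
  | add x y hx hy => simp only [map_add, hx, hy]
  | tmul p q => simp [tensorPairing]

/-- The products $b\,\varphi(\,\cdot\,q)$ determine $b\otimes\varphi$ on the range of $T_1$, hence
everywhere, and $\varphi\neq0$. -/
theorem IsLeftIntegral.dualMul_left_cancel (hφ : H.IsLeftIntegral φ) {b b₁ : dualSpace φ}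
    (h : ∀ b', hφ.dualMul b b' = hφ.dualMul b₁ b') : b = b₁ := by
  obtain ⟨y, hy⟩ := exists_apply_eq_one hφ.1
  refine Subtype.ext (LinearMap.ext fun x => ?_)
  have key (p q : A) : tensorFunctional (b : Module.Dual ℂ A) φ (H.T₁ (p ⊗ₜ q)) =
      tensorFunctional (b₁ : Module.Dual ℂ A) φ (H.T₁ (p ⊗ₜ q)) := by
    have := congrArg (fun f : dualSpace φ => (f : Module.Dual ℂ A) p)
      (h ⟨rightTranslate φ q, q, rfl⟩)
    rwa [hφ.dualMul_tmul _ ⟨rightTranslate φ q, q, rfl⟩ p q rfl,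
      hφ.dualMul_tmul _ ⟨rightTranslate φ q, q, rfl⟩ p q rfl] at this
  simpa [hy] using linearMap_ext_of_equiv H.T₁ key (x ⊗ₜ y)

end RegularMultiplierHopfAlgebra

/-! ### Coproduct, counit and antipode of the dual. -/

namespace RegularMultiplierHopfAlgebra

variable {A : Type*} [NonUnitalRing A] [Module ℂ A] [IsScalarTower ℂ A A] [SMulCommClass ℂ A A]
  {H : RegularMultiplierHopfAlgebra A} {φ ε : Module.Dual ℂ A} {S : A ≃ₗ[ℂ] A}

section DualMaps

/-- The bijection of `Â ⊗ Â` obtained from the flip of `A ⊗ A` composed with `T⁻¹`. -/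
def dualMap (F : A ≃ₗ[ℂ] dualSpace φ) (T : A ⊗[ℂ] A ≃ₗ[ℂ] A ⊗[ℂ] A) :
    dualSpace φ ⊗[ℂ] dualSpace φ ≃ₗ[ℂ] dualSpace φ ⊗[ℂ] dualSpace φ :=
  (TensorProduct.congr F F).symm ≪≫ₗ T.symm ≪≫ₗ TensorProduct.comm ℂ A A ≪≫ₗ
    TensorProduct.congr F F

theorem dualMap_tmul (F : A ≃ₗ[ℂ] dualSpace φ) (T : A ⊗[ℂ] A ≃ₗ[ℂ] A ⊗[ℂ] A) (c c' : A) :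
    dualMap F T (F c ⊗ₜ F c') = TensorProduct.map F.toLinearMap F.toLinearMap
      (TensorProduct.comm ℂ A A (T.symm (c ⊗ₜ c'))) := by
  have : (TensorProduct.congr F F).symm (F c ⊗ₜ F c') = c ⊗ₜ c' := by
    rw [LinearEquiv.symm_apply_eq, TensorProduct.congr_tmul]
  simp only [dualMap, LinearEquiv.trans_apply, this]
  rfl

variable {F Q : A ≃ₗ[ℂ] dualSpace φ} {SB : dualSpace φ ≃ₗ[ℂ] dualSpace φ}

/-- If $c\otimes c'=\Delta(p)(q\otimes1)$, left invariance gives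
$(\varphi\otimes\varphi)((a\otimes1)\Delta(a')(c\otimes c'))=\varphi(aq)\varphi(a'p)$. Hence the
inverse of $T_3$ and the flip. -/
theorem IsLeftIntegral.isDualT₁ (hφ : H.IsLeftIntegral φ)
    (hF : ∀ a x : A, (F a : Module.Dual ℂ A) x = φ (x * a)) :
    IsDualT₁ H φ (dualMap F H.T₃).toLinearMap := by
  intro b b' a a'
  obtain ⟨c, rfl⟩ := F.surjective b
  obtain ⟨c', rfl⟩ := F.surjective b'
  have h₁ : ∀ z : A ⊗[ℂ] A, tensorFunctional (F c : Module.Dual ℂ A) (F c') z =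
      tensorFunctional φ φ
        (TensorProduct.map (LinearMap.mulRight ℂ c) (LinearMap.mulRight ℂ c') z) := by
    intro z
    induction z with
    | zero => simp
    | add x y hx hy => simp only [map_add, hx, hy]
    | tmul p q => simp [hF]
  have h₂ : leftMul (tmulOne a) (leftMul (H.Δ a') (c ⊗ₜ c')) =
      TensorProduct.map (LinearMap.mulRight ℂ c) (LinearMap.mulRight ℂ c') (H.T₂ (a ⊗ₜ a')) :=
    HopfData.onFst_mul_dl (H := H.toHopfData) a a' c c'
  rw [LinearEquiv.coe_coe, dualMap_tmul, tensorPairing_tmul, h₁, ← h₂,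
    tensorFunctional_eq_sliceRight, sliceRight_leftMul_tmulOne]
  obtain ⟨z, hz⟩ := H.T₃.surjective (c ⊗ₜ c')
  rw [← hz, LinearEquiv.symm_apply_apply]
  clear hz h₁ h₂
  induction z with
  | zero => simp
  | add x y hx hy => simp only [map_add, LinearMap.add_apply, mul_add, hx, hy]
  | tmul p q =>
    rw [H.left_T₃, hφ.2.1]
    simp [tensorPairing, hF, mul_smul_comm, mul_comm]

theorem IsLeftIntegral.dualMul_eq (hφ : H.IsLeftIntegral φ)
    (hF : ∀ a x : A, (F a : Module.Dual ℂ A) x = φ (x * a)) (c c' : A) :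
    hφ.dualMul (F c) (F c') = F (sliceRight φ (H.T₃.symm (c ⊗ₜ c'))) := by
  refine Subtype.ext (LinearMap.ext fun x => ?_)
  rw [hφ.dualMul_apply (F c) (F c') c c' (LinearMap.ext (hF c)) (LinearMap.ext (hF c')),
    tensorFunctional_eq_sliceRight, hF]
  obtain ⟨z, hz⟩ := H.T₃.surjective (c ⊗ₜ c')
  rw [← hz, LinearEquiv.symm_apply_apply]
  clear hz
  induction z with
  | zero => simp
  | add x y hx hy => simp only [map_add, mul_add, hx, hy]
  | tmul p q =>
    rw [H.left_T₃, hφ.2.1]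
    simp [mul_smul_comm, mul_comm]

variable [Nontrivial A]

/-- The same computation with left translates of $\psi$: write $c\otimes c'=(1\otimes q)\Delta(p)$
and use right invariance. -/
theorem IsLeftIntegral.isDualT₂ (hφ : H.IsLeftIntegral φ) (hε : H.toHopfData.IsCounit ε)
    (hS : H.toHopfData.IsAntipode ε S.toLinearMap)
    (hQ : ∀ a x : A, (Q a : Module.Dual ℂ A) x = φ (S (a * x))) :
    IsDualT₂ H φ (dualMap Q H.T₄).toLinearMap := by
  intro b b' a a'
  obtain ⟨c, rfl⟩ := Q.surjective b
  obtain ⟨c', rfl⟩ := Q.surjective b'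
  let ψ : Module.Dual ℂ A := φ ∘ₗ S.toLinearMap
  have hψ (x y : A) : sliceLeft ψ (H.T₄ (x ⊗ₜ y)) = ψ y • x := hφ.isIntegral.sliceLeft_T₄ hε hS x y
  have h₁ : ∀ z : A ⊗[ℂ] A, tensorFunctional (Q c : Module.Dual ℂ A) (Q c') z =
      tensorFunctional ψ ψ (leftMul (oneTmul c') (leftMul (tmulOne c) z)) := by
    intro z
    induction z with
    | zero => simp
    | add x y hx hy => simp only [map_add, hx, hy]
    | tmul p q => simp [hQ, leftMul, oneTmul, tmulOne, ψ]
  have h₂ : ∀ z : A ⊗[ℂ] A, leftMul (oneTmul c') (rightMul (oneTmul a') z) =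
      rightMul (oneTmul a') (leftMul (oneTmul c') z) := by
    intro z
    induction z with
    | zero => simp
    | add x y hx hy => simp only [map_add, hx, hy]
    | tmul p q => simp [leftMul, rightMul, oneTmul, mul_assoc]
  rw [LinearEquiv.coe_coe, dualMap_tmul, tensorPairing_tmul, h₁, H.T₁_T₂, h₂,
    ← H.right_tmul_eq_T₂, tensorFunctional_eq_sliceLeft, sliceLeft_rightMul_oneTmul]
  obtain ⟨z, hz⟩ := H.T₄.surjective (c ⊗ₜ c')
  rw [← hz, LinearEquiv.symm_apply_apply]
  clear hz h₁ h₂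
  induction z with
  | zero => simp
  | add x y hx hy => simp only [map_add, LinearMap.add_apply, add_mul, hx, hy]
  | tmul q p =>
    rw [H.right_T₄, hψ]
    simp [tensorPairing, hQ, smul_mul_assoc, ψ]

theorem IsLeftIntegral.dualMul_eq_left (hφ : H.IsLeftIntegral φ) (hε : H.toHopfData.IsCounit ε)
    (hS : H.toHopfData.IsAntipode ε S.toLinearMap)
    (hQ : ∀ a x : A, (Q a : Module.Dual ℂ A) x = φ (S (a * x))) (c c' : A) :
    hφ.dualMul (Q c) (Q c') =
      Q (sliceLeft (φ ∘ₗ S.toLinearMap) (H.T₄.symm (c ⊗ₜ c'))) := by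
  let ψ : Module.Dual ℂ A := φ ∘ₗ S.toLinearMap
  have hψ (x y : A) : sliceLeft ψ (H.T₄ (x ⊗ₜ y)) = ψ y • x := hφ.isIntegral.sliceLeft_T₄ hε hS x y
  refine Subtype.ext (LinearMap.ext fun x => ?_)
  rw [hφ.dualMul_comp_antipode_left (hQ c), hQ, hQ, ← sliceLeft_leftMul_oneTmul,
    ← H.right_tmul_eq_T₂]
  change φ (S (sliceLeft ψ _)) = φ (S (sliceLeft ψ _ * x))
  obtain ⟨z, hz⟩ := H.T₄.surjective (c ⊗ₜ c')
  rw [← hz, LinearEquiv.symm_apply_apply]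
  clear hz
  induction z with
  | zero => simp
  | add x y hx hy => simp only [map_add, add_mul, hx, hy]
  | tmul q p =>
    rw [H.right_T₄, hψ]
    simp [smul_mul_assoc, ψ, mul_comm]

/-- Uniqueness goes in three stages: the pairing determines the dual $T_1$, its surjectivity
determines the counit and the values $m(SB'\otimes\iota)$, and left cancellation recovers $SB'$. -/
theorem IsLeftIntegral.isDualAntipode_iff (hφ : H.IsLeftIntegral φ)
    (hε : H.toHopfData.IsCounit ε) (hS : H.toHopfData.IsAntipode ε S.toLinearMap)
    (hF : ∀ a x : A, (F a : Module.Dual ℂ A) x = φ (x * a))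
    (hQ : ∀ a x : A, (Q a : Module.Dual ℂ A) x = φ (S (a * x)))
    (hFQ : ∀ v, φ (F.symm (Q v)) = φ (S v))
    (hSB : ∀ (b : dualSpace φ) (x : A),
      (SB b : Module.Dual ℂ A) x = (b : Module.Dual ℂ A) (S x))
    (SB' : dualSpace φ ≃ₗ[ℂ] dualSpace φ) : hφ.IsDualAntipode SB' ↔ SB' = SB := by
  let ψ : Module.Dual ℂ A := φ ∘ₗ S.toLinearMap
  -- Formally evaluation at $1$; by `hFQ` it can be computed from either representation of an
  -- element of the dual.
  let εB : Module.Dual ℂ (dualSpace φ) := φ ∘ₗ F.symm.toLinearMap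
  have hεF : εB ∘ₗ F.toLinearMap = φ := by
    ext a
    simp [εB]
  have hεQ : εB ∘ₗ Q.toLinearMap = ψ := LinearMap.ext hFQ
  have hT₁ := hφ.isDualT₁ hF
  have hT₂ := hφ.isDualT₂ hε hS hQ
  have h₁ (b b' : dualSpace φ) : sliceLeft εB (dualMap F H.T₃ (b ⊗ₜ b')) = hφ.dualMul b b' := by
    obtain ⟨c, rfl⟩ := F.surjective b
    obtain ⟨c', rfl⟩ := F.surjective b'
    rw [dualMap_tmul, sliceLeft_map, hεF, sliceLeft_comm, hφ.dualMul_eq hF]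
    rfl
  have h₂ (b b' : dualSpace φ) : sliceRight εB (dualMap Q H.T₄ (b ⊗ₜ b')) = hφ.dualMul b b' := by
    obtain ⟨c, rfl⟩ := Q.surjective b
    obtain ⟨c', rfl⟩ := Q.surjective b'
    rw [dualMap_tmul, sliceRight_map, hεQ, sliceRight_comm, hφ.dualMul_eq_left hε hS hQ]
    rfl
  have h₃ (b b' : dualSpace φ) : hφ.dualMulTensor (TensorProduct.map SB.toLinearMap LinearMap.id
      (dualMap F H.T₃ (b ⊗ₜ b'))) = εB b • b' := by
    obtain ⟨c, rfl⟩ := F.surjective b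
    obtain ⟨c', rfl⟩ := F.surjective b'
    have key : ∀ z : A ⊗[ℂ] A, hφ.dualMulTensor (TensorProduct.map SB.toLinearMap LinearMap.id
        (TensorProduct.map F.toLinearMap F.toLinearMap (TensorProduct.comm ℂ A A z))) =
          F (sliceLeft φ (H.T₃ z)) := by
      intro z
      induction z with
      | zero => simp
      | add x y hx hy => simp only [map_add, hx, hy]
      | tmul p q =>
        refine Subtype.ext (LinearMap.ext fun x => ?_)
        simp only [TensorProduct.comm_tmul, TensorProduct.map_tmul, LinearEquiv.coe_coe,
          LinearMap.id_apply, dualMulTensor_tmul]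
        rw [hF, hφ.dualMul_comp_antipode hε hS (fun x => by rw [hSB, hF]) (hF p)]
    rw [dualMap_tmul, key, LinearEquiv.apply_symm_apply, sliceLeft_tmul, map_smul]
    simp [εB]
  have h₄ (b b' : dualSpace φ) : hφ.dualMulTensor (TensorProduct.map LinearMap.id SB.toLinearMap
      (dualMap Q H.T₄ (b ⊗ₜ b'))) = εB b' • b := by
    obtain ⟨c, rfl⟩ := Q.surjective b
    obtain ⟨c', rfl⟩ := Q.surjective b'
    have key : ∀ z : A ⊗[ℂ] A, hφ.dualMulTensor (TensorProduct.map LinearMap.id SB.toLinearMap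
        (TensorProduct.map Q.toLinearMap Q.toLinearMap (TensorProduct.comm ℂ A A z))) =
          Q (sliceRight ψ (H.T₄ z)) := by
      intro z
      induction z with
      | zero => simp
      | add x y hx hy => simp only [map_add, hx, hy]
      | tmul q p =>
        refine Subtype.ext (LinearMap.ext fun x => ?_)
        simp only [TensorProduct.comm_tmul, TensorProduct.map_tmul, LinearEquiv.coe_coe,
          LinearMap.id_apply, dualMulTensor_tmul]
        rw [hQ, hφ.dualMul_comp_antipode_right hε hS (hQ p) (fun x => by rw [hSB, hQ])]
    have hc' : εB (Q c') = ψ c' := hFQ c'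
    rw [dualMap_tmul, key, LinearEquiv.apply_symm_apply, sliceRight_tmul, map_smul, hc']
  constructor
  · rintro ⟨T₁', T₂', εB', hT₁', -, h₁', -, h₃', -⟩
    have hT : T₁' = (dualMap F H.T₃).toLinearMap := TensorProduct.ext' fun b b' =>
      tensorPairing_injective (funext fun a => funext fun a' =>
        (hT₁' b b' a a').trans (hT₁ b b' a a').symm)
    have hε' : εB' = εB := by
      obtain ⟨u, hu⟩ := exists_ne (0 : A)
      ext b
      have := linearMap_ext_of_equiv (dualMap F H.T₃) (f := sliceLeft εB') (g := sliceLeft εB)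
        (fun b b' => by rw [h₁, ← h₁', hT]; rfl) (b ⊗ₜ F u)
      simpa [hu] using this
    refine LinearEquiv.ext fun b => hφ.dualMul_left_cancel fun b' => ?_
    have := linearMap_ext_of_equiv (dualMap F H.T₃)
      (f := hφ.dualMulTensor ∘ₗ onFst SB'.toLinearMap)
      (g := hφ.dualMulTensor ∘ₗ onFst SB.toLinearMap)
      (fun b b' => by
        have h := h₃' b b'
        rw [hT, hε', ← h₃] at h
        exact h) (b ⊗ₜ b')
    simpa using this
  · rintro rfl
    exact ⟨_, _, εB, hT₁, hT₂, h₁, h₂, h₃, h₄⟩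

end DualMaps

end RegularMultiplierHopfAlgebra

end MHA

end

theorem mainTheorem8 {A : Type*} [NonUnitalRing A] [Module ℂ A] [IsScalarTower ℂ A A]
    [SMulCommClass ℂ A A] (H : MHA.RegularMultiplierHopfAlgebra A) (φ : Module.Dual ℂ A)
    (hφ : H.IsLeftIntegral φ) :
    -- the counit `ε` and the antipode `S` of `A`
    ∃ (ε : A →ₙₐ[ℂ] ℂ) (S : A ≃ₗ[ℂ] A),
      (∀ ε' : A →ₙₐ[ℂ] ℂ, H.IsCounit ε' ↔ ε' = ε) ∧
      (∀ S' : A ≃ₗ[ℂ] A, H.IsAntipode ε S' ↔ S' = S) ∧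
      -- the maps `F a = φ(· a)` and `G a = ψ(S(·) a)` are bijections of `A` onto the dual `B`;
      -- the antipode `SB` of `B`, and the functionals `ψh`, `φh` on `B`
      ∃ (F G : A ≃ₗ[ℂ] MHA.dualSpace φ) (SB : MHA.dualSpace φ ≃ₗ[ℂ] MHA.dualSpace φ)
        (ψh φh : Module.Dual ℂ (MHA.dualSpace φ)),
        (∀ a x : A, (F a : Module.Dual ℂ A) x = φ (x * a)) ∧
        (∀ a x : A, (G a : Module.Dual ℂ A) x = MHA.rightIntegral φ S (S x * a)) ∧
        (∀ SB' : MHA.dualSpace φ ≃ₗ[ℂ] MHA.dualSpace φ, hφ.IsDualAntipode SB' ↔ SB' = SB) ∧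
        (∀ (b : MHA.dualSpace φ) (x : A),
          (SB b : Module.Dual ℂ A) x = (b : Module.Dual ℂ A) (S x)) ∧
        (∀ a : A, ψh (F a) = ε a) ∧
        (∀ a : A, φh (G a) = ε a) ∧
        -- the inverse of `F` sends `b` to the element `ψh(SB(·) b)` of `A`
        (∀ (b : MHA.dualSpace φ) (a : A), F.symm b = a ↔
          ∀ b' : MHA.dualSpace φ, (b' : Module.Dual ℂ A) a = ψh (hφ.dualMul (SB b') b)) ∧
        -- the inverse of `G` sends `b` to the element `φh(· b)` of `A`
        (∀ (b : MHA.dualSpace φ) (a : A), G.symm b = a ↔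
          ∀ b' : MHA.dualSpace φ, (b' : Module.Dual ℂ A) a = φh (hφ.dualMul b' b)) := by
  have := hφ.nontrivial
  obtain ⟨ε₀, hε⟩ := H.toHopfData.exists_isCounit
  obtain ⟨S, hS, -⟩ := hφ.isIntegral.exists_antipode_equiv hε
  obtain ⟨F, G, Q, SB, hF, hG, hQ, hFQ, hSB⟩ := hφ.exists_equivs hε hS
  let ε : A →ₙₐ[ℂ] ℂ :=
    { toFun := ε₀
      map_smul' := map_smul ε₀
      map_zero' := map_zero ε₀
      map_add' := map_add ε₀
      map_mul' := hε.map_mul }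
  have hS₂ (a b : A) : MHA.mulTensor A (TensorProduct.map LinearMap.id S.toLinearMap
      (H.T₂ (a ⊗ₜ b))) = ε b • a := hS.lift_onSnd_T₂ hε a b
  -- Faithfulness in the other variable, obtained in the opposite algebra.
  have separate {a a' : A} (h : ∀ c, φ (a * c) = φ (a' * c)) : a = a' :=
    sub_eq_zero.1 (hφ.isIntegral.op.faithful fun c => by
      change φ ((a - a') * c) = 0
      rw [sub_mul, map_sub, h, sub_self])
  refine ⟨ε, S, fun ε' => ⟨fun h => ?_, ?_⟩, fun S' => ⟨fun h => ?_, ?_⟩, F, G, SB,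
    ε₀ ∘ₗ F.symm.toLinearMap, ε₀ ∘ₗ G.symm.toLinearMap, hF, hG,
    hφ.isDualAntipode_iff hε hS hF hQ hFQ hSB, hSB, fun a => ?_, fun a => ?_, fun b a => ?_,
    fun b a => ?_⟩
  · have := hε.eq_of_sliceLeft (ε' := (ε' : A →ₗ[ℂ] ℂ)) h.1
    ext a
    exact LinearMap.congr_fun this a
  · rintro rfl
    exact hε
  · have := hS.unique (S' := S'.toLinearMap) h.1
    ext a
    exact LinearMap.congr_fun this a
  · rintro rfl
    exact ⟨hS, hS₂⟩
  · change ε₀ (F.symm (F a)) = ε₀ a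
    rw [F.symm_apply_apply]
  · change ε₀ (G.symm (G a)) = ε₀ a
    rw [G.symm_apply_apply]
  · obtain ⟨a₀, rfl⟩ := F.surjective b
    -- The product is $F((\varphi\otimes\iota)(\Delta(a_0)(c\otimes1)))$, and $\varepsilon$ of its
    -- argument is $\varphi$ of $(\iota\otimes\varepsilon)(\Delta(a_0)(c\otimes1))=a_0c$.
    have key (c : A) : ε₀ (F.symm (hφ.dualMul (SB (F c)) (F a₀))) = φ (a₀ * c) := by
      have h : hφ.dualMul (SB (F c)) (F a₀) = F (MHA.sliceLeft φ (H.T₃ (a₀ ⊗ₜ c))) :=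
        Subtype.ext (LinearMap.ext fun x => by
          rw [hF, hφ.dualMul_comp_antipode hε hS (fun x => by rw [hSB, hF]) (hF a₀)])
      rw [h, F.symm_apply_apply, MHA.apply_sliceLeft]
      exact congrArg φ (hε.sliceRight_T₃ a₀ c)
    rw [F.symm_apply_apply]
    refine ⟨?_, fun h => separate fun c => ?_⟩
    · rintro rfl b'
      obtain ⟨c, rfl⟩ := F.surjective b'
      exact (hF c a₀).trans (key c).symm
    · rw [← key, ← hF, h]
      rfl
  · obtain ⟨a₀, rfl⟩ := G.surjective b
    -- The test functionals are written as $F(c)$, not $G(c)$, so that their value at $a_0$ is again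
    -- $\varphi(a_0c)$.
    have key (c : A) : ε₀ (G.symm (hφ.dualMul (F c) (G a₀))) = φ (a₀ * c) := by
      have h : hφ.dualMul (F c) (G a₀) = G (MHA.sliceRight φ (H.T₁ (a₀ ⊗ₜ c))) :=
        Subtype.ext (LinearMap.ext fun x => by
          rw [hG, hφ.dualMul_rightTranslate hε hS (hF c) (hG a₀)])
      rw [h, G.symm_apply_apply, ← MHA.apply_sliceLeft]
      exact congrArg φ (hε.1 a₀ c)
    rw [G.symm_apply_apply]
    refine ⟨?_, fun h => separate fun c => ?_⟩
    · rintro rfl b'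
      obtain ⟨c, rfl⟩ := F.surjective b'
      exact (hF c a₀).trans (key c).symm
    · rw [← key, ← hF, h]
      rfl
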